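/- **Setting.** Let $m$ be Lebesgue measure and let scalars be real or complex. An *Orlicz function* is a continuous, increasing, convex function $\Phi:[0,\infty)\to[0,\infty)$ with $\Phi(0)=0$ and $\lim_{t\to\infty}\Phi(t)=\infty$. It satisfies $\Delta_2$ if there is $C>0$ with $\Phi(2t)\le C\,\Phi(t)$ for all $t>0$. $L_\Phi(0,1)$ is the space of measurable $f$ on $(0,1)$ such that $\int_0^1\Phi(|f(t)|/\lambda)\,dt\le 1$ for some $\lambda>0$. For a bounded scalar sequence $a=(a_k)_{k\ge0}$ put $\mu(n,a)=\inf\{\lambda\ge0:\ \mathrm{Card}\{k:|a_k|>\lambda\}\le n\}$ for $n\ge0$. A *quasi-Banach symmetric sequence space* is a nonzero linear space $E$ of bounded scalar sequences with a complete quasi-norm $\|\cdot\|_E$ (that is, $\|x\|_E=0$ iff $x=0$; $\|\alpha x\|_E=|\alpha|\|x\|_E$; $\|x+y\|_E\le C_E(\|x\|_E+\|y\|_E)$; every Cauchy sequence converges) such that whenever $a\in E$, $b$ is a bounded sequence and $\mu(n,b)\le\mu(n,a)$ for all $n\ge 0$, then $b\in E$ and $\|b\|_E\le\|a\|_E$.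 Finite sequences are regarded as elements of $E$ by continuing them by zeros. For measurable functions $f_0,\dots,f_{n-1}$ on $(0,1)$ their *disjoint sum* $f=\bigoplus_{k=0}^{n-1}f_k$ is the function on $(0,\infty)$ equal to $f_k(t-k)$ for $t\in(k,k+1)$, $0\le k<n$, and $0$ elsewhere. Its decreasing rearrangement is $\mu(t,f)=\inf\{\lambda\ge0:\ m(\{s>0:|f(s)|>\lambda\})<t\}$, $t>0$. **Theorem.** Let $\Phi$ be an Orlicz function satisfying $\Delta_2$ and let $E$ be a quasi-Banach symmetric sequence space. There are constants $c,C>0$ depending only on $E$ and $\Phi$ such that for every $n\in\mathbb N$, every sequence $(f_k)_{k=0}^{n-1}\subset L_\Phi(0,1)$ of independent random variables on $(0,1)$, and $f=\bigoplus_{k=0}^{n-1}f_k$, both integrals below are finite and $$c\,R\ \le\ \int_0^1\Phi\Big(\big\|(f_k(t))_{k=0}^{n-1}\big\|_E\Big)dt\ \le\ C\,R,\qquad R=\int_0^1\Phi(\mu(t,f))\,dt+\Phi\Big(\big\|(\mu(k,f))_{k=1}^{n}\big\|_E\Big).$$ -/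

import Mathlib

open MeasureTheory ProbabilityTheory Filter Topology

/-- `Φ` (used only on `[0,∞)`) is an Orlicz function: continuous, increasing and convex,
with `Φ 0 = 0` and `Φ t → ∞` as `t → ∞`. -/
structure IsOrlicz (Φ : ℝ → ℝ) : Prop where
  continuousOn : ContinuousOn Φ (Set.Ici 0)
  monotoneOn : MonotoneOn Φ (Set.Ici 0)
  convexOn : ConvexOn ℝ (Set.Ici 0) Φ
  map_zero : Φ 0 = 0
  tendsto_atTop : Tendsto Φ atTop atTop

/-- The `Δ₂`-condition. -/
def DeltaTwo (Φ : ℝ → ℝ) : Prop :=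
  ∃ C : ℝ, 0 < C ∧ ∀ t : ℝ, 0 < t → Φ (2 * t) ≤ C * Φ t

/-- Lebesgue measure on the interval `(0,1)`. -/
noncomputable def unitMeasure : Measure ℝ := volume.restrict (Set.Ioo 0 1)

/-- The Luxemburg norm on `(0,1)`, with value `∞` when no admissible `c` exists. -/
noncomputable def orliczNorm {𝕜 : Type*} [RCLike 𝕜] (Φ : ℝ → ℝ) (f : ℝ → 𝕜) : ENNReal :=
  ⨅ (c : ℝ) (_ : 0 < c)
    (_ : ∫⁻ t, ENNReal.ofReal (Φ (‖f t‖ / c)) ∂unitMeasure ≤ 1), ENNReal.ofReal c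

/-- Membership in the Orlicz space `L_Φ(0,1)`: `f` is Lebesgue measurable on `(0,1)` and has
finite Luxemburg norm. -/
def MemOrlicz {𝕜 : Type*} [RCLike 𝕜] (Φ : ℝ → ℝ) (f : ℝ → 𝕜) : Prop :=
  AEMeasurable f unitMeasure ∧ orliczNorm Φ f < ⊤

/-- The decreasing rearrangement
`μ(t,f) = inf {c ≥ 0 : m {s ∈ (0,∞) : |f s| > c} < t}`, `t > 0`, of a function on `(0,∞)`. -/
noncomputable def rearrangement {𝕜 : Type*} [RCLike 𝕜] (f : ℝ → 𝕜) (t : ℝ) : ℝ :=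
  sInf {c : ℝ | 0 ≤ c ∧ volume {s : ℝ | 0 < s ∧ c < ‖f s‖} < ENNReal.ofReal t}

/-- The disjoint sum of functions `f 0, …, f (n-1)` on `(0,1)`: the function on `(0,∞)` that
equals `t ↦ f k (t - k)` on `(k,k+1)` for `k < n` and vanishes elsewhere. -/
noncomputable def disjointSum {𝕜 : Type*} [RCLike 𝕜] {n : ℕ} (f : Fin n → ℝ → 𝕜) : ℝ → 𝕜 :=
  fun t => ∑ k : Fin n,
    (Set.Ioo (k : ℝ) ((k : ℝ) + 1)).indicator (fun s => f k (s - (k : ℝ))) t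

/-- A bounded scalar sequence. -/
def BoundedSeq {𝕜 : Type*} [RCLike 𝕜] (a : ℕ → 𝕜) : Prop :=
  ∃ C : ℝ, ∀ k, ‖a k‖ ≤ C

/-- The decreasing rearrangement `μ(n,a) = inf {c ≥ 0 : Card {k : |a k| > c} ≤ n}` of a bounded
sequence. -/
noncomputable def seqRearrangement {𝕜 : Type*} [RCLike 𝕜] (a : ℕ → 𝕜) (n : ℕ) : ℝ :=
  sInf {c : ℝ | 0 ≤ c ∧ {k : ℕ | c < ‖a k‖}.encard ≤ (n : ℕ∞)}

/-- A nonzero quasi-Banach symmetric sequence space over `𝕜`: a linear space `carrier` of bounded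
sequences with a complete quasi-norm that is monotone under decreasing rearrangement.
Only the values of `qnorm` on `carrier` are meaningful. By `symm` and `nontrivial` the space
contains the standard unit vectors, hence all finitely supported sequences. -/
structure SymmSeqSpace (𝕜 : Type*) [RCLike 𝕜] where
  /-- the underlying linear space of sequences -/
  carrier : Submodule 𝕜 (ℕ → 𝕜)
  /-- the quasi-norm -/
  qnorm : (ℕ → 𝕜) → ℝ
  bounded : ∀ a ∈ carrier, BoundedSeq a
  nontrivial : ∃ a ∈ carrier, a ≠ 0
  qnorm_nonneg : ∀ a ∈ carrier, 0 ≤ qnorm a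
  qnorm_eq_zero_iff : ∀ a ∈ carrier, (qnorm a = 0 ↔ a = 0)
  qnorm_smul : ∀ (r : 𝕜), ∀ a ∈ carrier, qnorm (r • a) = ‖r‖ * qnorm a
  qnorm_add_le : ∃ C : ℝ, 0 < C ∧
    ∀ a ∈ carrier, ∀ b ∈ carrier, qnorm (a + b) ≤ C * (qnorm a + qnorm b)
  complete : ∀ x : ℕ → (ℕ → 𝕜), (∀ i, x i ∈ carrier) →
    (∀ ε : ℝ, 0 < ε → ∃ N : ℕ, ∀ i ≥ N, ∀ j ≥ N, qnorm (x i - x j) < ε) →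
    ∃ a ∈ carrier, Tendsto (fun i => qnorm (x i - a)) atTop (𝓝 0)
  symm : ∀ a ∈ carrier, ∀ b : ℕ → 𝕜, BoundedSeq b →
    (∀ n, seqRearrangement b n ≤ seqRearrangement a n) → b ∈ carrier ∧ qnorm b ≤ qnorm a

/-- A finite sequence, continued by zeros. -/
def extendZero {𝕜 : Type*} [RCLike 𝕜] {n : ℕ} (x : Fin n → 𝕜) : ℕ → 𝕜 :=
  fun k => if h : k < n then x ⟨k, h⟩ else 0

/-! Passing to moduli, let `X k` be nonnegative independent variables and let `l` be the sum of
their laws. Then `l (Ioi c)` is the distribution function of the disjoint sum, and μ(·,f) is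
`tailQuantile l`. A symmetric quasi-norm is controlled by the counting function c ↦ Card{k : |a_k| >
c}: doubling that function costs a constant factor, and by Δ₂ it also costs a constant factor K in
the modular Φ(‖a‖_E). It therefore suffices to compare the random counts `hitCount X (Ioi c)` with
their means `l (Ioi c)`. Independence does this through the exponential moment E a^hits ≤ exp((a-1)
l(S)), `lintegral_pow_hitCount_le`.

Lower bound. The largest `X k` is dominated by the quasi-norm and exceeds c with probability at
least min(l(c,∞),1)/2, which handles ∫Φ(μ(t,f))dt. For the sequence part, Chernoff's bound shows
that, outside an event of probability at most 1/3, at every dyadic level from 16 on with a positive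
quantile at least half of the expected number of variables reach it. There (μ(k,f)) is
deterministically controlled by the random sequence together with one entry μ(1,f), and Markov's
inequality finishes (`modular_quantileSeq_le`).

Upper bound. Split at m = μ(1,f). Above m there are Z entries, with EZ ≤ 1, so their modular is at
most K·K^Z ΣΦ(X_k); independence separates K^Z from Φ(X_k), and the part of `l` above m is carried
by μ on (0,1). Below m, let r be the smallest integer for which the count above μ(2^j,f) is at most
2^j(r+K) for all j. The counting function then exceeds that of (μ(k,f)) by at most 2^(r+K+1), and E
K^r ≤ 2: exponential moments of the counts in base K beat the growth K^r of the modular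
(`lintegral_levelExcess_le`). -/

open scoped ENNReal

/-! ### Orlicz functions -/

theorem IsOrlicz.mono {Φ : ℝ → ℝ} (hΦ : IsOrlicz Φ) {s t : ℝ} (hs : 0 ≤ s) (hst : s ≤ t) :
    Φ s ≤ Φ t :=
  hΦ.monotoneOn hs (hs.trans hst) hst

theorem IsOrlicz.nonneg {Φ : ℝ → ℝ} (hΦ : IsOrlicz Φ) {t : ℝ} (ht : 0 ≤ t) : 0 ≤ Φ t := by
  simpa [hΦ.map_zero] using hΦ.mono le_rfl ht

theorem IsOrlicz.continuous_max {Φ : ℝ → ℝ} (hΦ : IsOrlicz Φ) :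
    Continuous fun x => Φ (max x 0) :=
  hΦ.continuousOn.comp_continuous (by fun_prop) fun x => le_max_right x 0

theorem IsOrlicz.aemeasurable_comp {Φ : ℝ → ℝ} (hΦ : IsOrlicz Φ) {Ω : Type*} [MeasurableSpace Ω]
    {μ : Measure Ω} {X : Ω → ℝ} (hX : AEMeasurable X μ) (hX0 : ∀ ω, 0 ≤ X ω) :
    AEMeasurable (fun ω => Φ (X ω)) μ := by
  have := hΦ.continuous_max.measurable.comp_aemeasurable hX
  simpa [Function.comp_def, max_eq_left (hX0 _)] using this

theorem DeltaTwo.exists_mul_le {Φ : ℝ → ℝ} (hΔ : DeltaTwo Φ) (hΦ : IsOrlicz Φ) {s : ℝ}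
    (hs : 0 ≤ s) : ∃ K : ℝ, 1 ≤ K ∧ ∀ t, 0 ≤ t → Φ (s * t) ≤ K * Φ t := by
  obtain ⟨C, -, hC⟩ := hΔ
  have hC' : ∀ t, 0 ≤ t → Φ (2 * t) ≤ max C 1 * Φ t := by
    intro t ht
    rcases ht.eq_or_lt with rfl | ht'
    · simp [hΦ.map_zero]
    · exact (hC t ht').trans (mul_le_mul_of_nonneg_right (le_max_left _ _) (hΦ.nonneg ht))
  have hpow : ∀ b : ℕ, ∀ t, 0 ≤ t → Φ (2 ^ b * t) ≤ max C 1 ^ b * Φ t := by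
    intro b
    induction b with
    | zero => simp
    | succ b ih =>
      intro t ht
      calc Φ (2 ^ (b + 1) * t) = Φ (2 * (2 ^ b * t)) := by ring_nf
        _ ≤ max C 1 * Φ (2 ^ b * t) := hC' _ (by positivity)
        _ ≤ max C 1 * (max C 1 ^ b * Φ t) := by gcongr; exact ih t ht
        _ = max C 1 ^ (b + 1) * Φ t := by ring
  obtain ⟨b, hb⟩ := pow_unbounded_of_one_lt s (one_lt_two : (1 : ℝ) < 2)
  exact ⟨max C 1 ^ b, one_le_pow₀ (le_max_right _ _), fun t ht =>
    (hΦ.mono (by positivity) (by gcongr)).trans (hpow b t ht)⟩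

/-- The threshold is the largest point of the sublevel set {Φ ≤ s}, which is closed by continuity
and bounded because Φ tends to infinity. This turns tails of Φ(X) into tails of X even where Φ is
not strictly increasing. -/
theorem IsOrlicz.exists_lt_iff {Φ : ℝ → ℝ} (hΦ : IsOrlicz Φ) {s : ℝ} (hs : 0 ≤ s) :
    ∃ a : ℝ, 0 ≤ a ∧ ∀ x, 0 ≤ x → (s < Φ x ↔ a < x) := by
  let S : Set ℝ := {x | 0 ≤ x ∧ Φ x ≤ s}
  have h0 : (0 : ℝ) ∈ S := ⟨le_rfl, by rwa [hΦ.map_zero]⟩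
  have hbdd : BddAbove S := by
    obtain ⟨b, hb⟩ := (hΦ.tendsto_atTop.eventually_gt_atTop s).exists_forall_of_atTop
    refine ⟨b, fun x hx => ?_⟩
    by_contra! h
    exact absurd (hb x h.le) (not_lt.2 hx.2)
  have hclosed : IsClosed S := by
    have : S = Set.Ici 0 ∩ Φ ⁻¹' Set.Iic s := rfl
    rw [this]
    exact hΦ.continuousOn.preimage_isClosed_of_isClosed isClosed_Ici isClosed_Iic
  have hmem := hclosed.csSup_mem ⟨0, h0⟩ hbdd
  refine ⟨sSup S, hmem.1, fun x hx => ⟨fun h => ?_, fun h => ?_⟩⟩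
  · by_contra! h'
    exact absurd (hΦ.mono hx h') (not_le.2 (hmem.2.trans_lt h))
  · by_contra! h'
    exact absurd (le_csSup hbdd (show x ∈ S from ⟨hx, h'⟩)) (not_le.2 h)

/-- Comparison of `Φ`-moments from a comparison of tails. -/
theorem IsOrlicz.lintegral_le_of_tail {Φ : ℝ → ℝ} (hΦ : IsOrlicz Φ) {Ω Ω' : Type*}
    [MeasurableSpace Ω] [MeasurableSpace Ω'] {μ : Measure Ω} {ν : Measure Ω'}
    {X : Ω → ℝ} {Y : Ω' → ℝ} (hX : AEMeasurable X μ) (hY : AEMeasurable Y ν)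
    (hX0 : ∀ ω, 0 ≤ X ω) (hY0 : ∀ ω, 0 ≤ Y ω) {κ : ℝ≥0∞} (hκ : κ ≠ ⊤)
    (h : ∀ c, 0 ≤ c → ν {ω | c < Y ω} ≤ κ * μ {ω | c < X ω}) :
    ∫⁻ ω, ENNReal.ofReal (Φ (Y ω)) ∂ν ≤ κ * ∫⁻ ω, ENNReal.ofReal (Φ (X ω)) ∂μ := by
  -- Layer-cake formula on both sides; the tails are then compared level by level.
  rw [lintegral_eq_lintegral_meas_lt ν (Eventually.of_forall fun ω => hΦ.nonneg (hY0 ω))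
      (hΦ.aemeasurable_comp hY hY0),
    lintegral_eq_lintegral_meas_lt μ (Eventually.of_forall fun ω => hΦ.nonneg (hX0 ω))
      (hΦ.aemeasurable_comp hX hX0), ← lintegral_const_mul' _ _ hκ]
  refine setLIntegral_mono' measurableSet_Ioi fun s hs => ?_
  obtain ⟨a, ha, hiff⟩ := hΦ.exists_lt_iff (le_of_lt hs)
  simpa only [hiff _ (hX0 _), hiff _ (hY0 _)] using h a ha

theorem IsOrlicz.lintegral_lt_top {Φ : ℝ → ℝ} (hΦ : IsOrlicz Φ) (hΔ : DeltaTwo Φ)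
    {𝕜 : Type*} [RCLike 𝕜] {f : ℝ → 𝕜} (hf : MemOrlicz Φ f) :
    ∫⁻ t, ENNReal.ofReal (Φ ‖f t‖) ∂unitMeasure < ⊤ := by
  have h := hf.2
  simp only [orliczNorm, iInf_lt_iff] at h
  obtain ⟨c, hc, hle, -⟩ := h
  obtain ⟨K, hK, hK'⟩ := hΔ.exists_mul_le hΦ hc.le
  calc ∫⁻ t, ENNReal.ofReal (Φ ‖f t‖) ∂unitMeasure
      ≤ ∫⁻ t, ENNReal.ofReal K * ENNReal.ofReal (Φ (‖f t‖ / c)) ∂unitMeasure := by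
        refine lintegral_mono fun t => ?_
        rw [← ENNReal.ofReal_mul (by positivity)]
        refine ENNReal.ofReal_le_ofReal ?_
        have := hK' (‖f t‖ / c) (by positivity)
        rwa [mul_div_cancel₀ _ hc.ne'] at this
    _ = ENNReal.ofReal K * ∫⁻ t, ENNReal.ofReal (Φ (‖f t‖ / c)) ∂unitMeasure :=
        lintegral_const_mul' _ _ ENNReal.ofReal_ne_top
    _ ≤ ENNReal.ofReal K * 1 := by gcongr
    _ < ⊤ := by simp

/-! ### The decreasing rearrangement of a measure on the line -/

/-- The decreasing rearrangement of a nonnegative function with distribution `l`. -/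
noncomputable def tailQuantile (l : Measure ℝ) (t : ℝ) : ℝ :=
  sInf {c : ℝ | 0 ≤ c ∧ l (Set.Ioi c) < ENNReal.ofReal t}

theorem tailQuantile_nonneg (l : Measure ℝ) (t : ℝ) : 0 ≤ tailQuantile l t :=
  Real.sInf_nonneg fun _ h => h.1

theorem bddBelow_tailQuantile (l : Measure ℝ) (t : ℝ) :
    BddBelow {c : ℝ | 0 ≤ c ∧ l (Set.Ioi c) < ENNReal.ofReal t} :=
  ⟨0, fun _ h => h.1⟩

theorem le_measure_Ioi_of_lt_tailQuantile {l : Measure ℝ} {c t : ℝ} (hc : 0 ≤ c)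
    (h : c < tailQuantile l t) : ENNReal.ofReal t ≤ l (Set.Ioi c) := by
  by_contra! h'
  exact notMem_of_lt_csInf h (bddBelow_tailQuantile l t) ⟨hc, h'⟩

section

variable {l : Measure ℝ} [IsFiniteMeasure l] {t : ℝ}

theorem tailQuantile_set_nonempty (ht : 0 < t) :
    {c : ℝ | 0 ≤ c ∧ l (Set.Ioi c) < ENNReal.ofReal t}.Nonempty := by
  have h : Tendsto (fun n : ℕ => l (Set.Ioi (n : ℝ))) atTop (𝓝 (l (⋂ n : ℕ, Set.Ioi (n : ℝ)))) :=
    tendsto_measure_iInter_atTop (fun n => measurableSet_Ioi.nullMeasurableSet)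
      (fun m n hmn => Set.Ioi_subset_Ioi (by exact_mod_cast hmn)) ⟨0, measure_ne_top _ _⟩
  have he : ⋂ n : ℕ, Set.Ioi (n : ℝ) = ∅ := by
    refine Set.eq_empty_of_forall_notMem fun x hx => ?_
    obtain ⟨n, hn⟩ := exists_nat_gt x
    exact absurd (Set.mem_iInter.1 hx n) (not_lt.2 hn.le)
  rw [he, measure_empty] at h
  obtain ⟨n, hn⟩ := (h.eventually_lt_const (ENNReal.ofReal_pos.2 ht)).exists
  exact ⟨n, n.cast_nonneg, hn⟩

theorem tailQuantile_antitoneOn (l : Measure ℝ) [IsFiniteMeasure l] :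
    AntitoneOn (tailQuantile l) (Set.Ioi 0) := fun _ hs _ _ hst =>
  csInf_le_csInf (bddBelow_tailQuantile _ _) (tailQuantile_set_nonempty hs) fun _ hc =>
    ⟨hc.1, hc.2.trans_le (ENNReal.ofReal_le_ofReal hst)⟩

/-- Right continuity of the tail: if it exceeds t at c, it still does slightly to the right of c. -/
theorem lt_tailQuantile_of_lt_measure_Ioi {c : ℝ} (ht : 0 < t)
    (h : ENNReal.ofReal t < l (Set.Ioi c)) : c < tailQuantile l t := by
  have hU : Set.Ioi c = ⋃ n : ℕ, Set.Ioi (c + 1 / ((n : ℝ) + 1)) := by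
    ext x
    simp only [Set.mem_Ioi, Set.mem_iUnion]
    constructor
    · intro hx
      obtain ⟨n, hn⟩ := exists_nat_one_div_lt (sub_pos.2 hx)
      exact ⟨n, by linarith⟩
    · rintro ⟨n, hn⟩
      have : 0 < 1 / ((n : ℝ) + 1) := by positivity
      linarith
  have hlim : Tendsto (fun n : ℕ => l (Set.Ioi (c + 1 / ((n : ℝ) + 1)))) atTop
      (𝓝 (l (Set.Ioi c))) := by
    rw [hU]
    refine tendsto_measure_iUnion_atTop fun m n hmn => Set.Ioi_subset_Ioi ?_
    gcongr
  obtain ⟨n, hn⟩ := (hlim.eventually_const_lt h).exists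
  have hpos : 0 < 1 / ((n : ℝ) + 1) := by positivity
  refine lt_of_lt_of_le (show c < c + 1 / ((n : ℝ) + 1) by linarith)
    (le_csInf (tailQuantile_set_nonempty ht) fun d hd => ?_)
  by_contra! hlt
  exact absurd (hd.2.trans hn) (not_lt.2 (measure_mono (Set.Ioi_subset_Ioi hlt.le)))

theorem measure_Ioi_tailQuantile_le (ht : 0 < t) :
    l (Set.Ioi (tailQuantile l t)) ≤ ENNReal.ofReal t := by
  by_contra! h
  exact lt_irrefl _ (lt_tailQuantile_of_lt_measure_Ioi ht h)

/-- Approach the quantile from the left and use continuity from above. Atoms at the quantile force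
the closed half-line here and the open one in the opposite bound. Positivity is needed because only
levels c ≥ 0 compete in the infimum. -/
theorem le_measure_Ici_tailQuantile (h : 0 < tailQuantile l t) :
    ENNReal.ofReal t ≤ l (Set.Ici (tailQuantile l t)) := by
  set m := tailQuantile l t
  have hI : Set.Ici m = ⋂ n : ℕ, Set.Ioi (m - m / ((n : ℝ) + 1)) := by
    ext x
    simp only [Set.mem_Ici, Set.mem_iInter, Set.mem_Ioi]
    constructor
    · intro hx n
      have : 0 < m / ((n : ℝ) + 1) := by positivity
      linarith
    · intro hx
      by_contra! hlt
      obtain ⟨n, hn⟩ := exists_nat_one_div_lt (div_pos (sub_pos.2 hlt) h)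
      rw [lt_div_iff₀ h] at hn
      have := hx n
      have h2 : m / ((n : ℝ) + 1) = 1 / ((n : ℝ) + 1) * m := by ring
      linarith
  have hlim : Tendsto (fun n : ℕ => l (Set.Ioi (m - m / ((n : ℝ) + 1)))) atTop
      (𝓝 (l (Set.Ici m))) := by
    rw [hI]
    refine tendsto_measure_iInter_atTop (fun n => measurableSet_Ioi.nullMeasurableSet)
      (fun a b hab => Set.Ioi_subset_Ioi ?_) ⟨0, measure_ne_top _ _⟩
    gcongr
  refine ge_of_tendsto' hlim fun n => ?_
  have h1 : m / ((n : ℝ) + 1) ≤ m := div_le_self h.le (by simp)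
  have h2 : 0 < m / ((n : ℝ) + 1) := by positivity
  exact le_measure_Ioi_of_lt_tailQuantile (by linarith) (show _ < m by linarith)

theorem unitMeasure_apply (S : Set ℝ) : unitMeasure S = volume (S ∩ Set.Ioo 0 1) :=
  Measure.restrict_apply' measurableSet_Ioo

instance isProbabilityMeasure_unitMeasure : IsProbabilityMeasure unitMeasure := ⟨by simp [unitMeasure_apply]⟩

theorem aemeasurable_tailQuantile (l : Measure ℝ) [IsFiniteMeasure l] :
    AEMeasurable (tailQuantile l) unitMeasure :=
  aemeasurable_restrict_of_antitoneOn measurableSet_Ioo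
    ((tailQuantile_antitoneOn l).mono fun _ h => h.1)

theorem unitMeasure_lt_tailQuantile_le {c : ℝ} (hc : 0 ≤ c) :
    unitMeasure {t | c < tailQuantile l t} ≤ l (Set.Ioi c) := by
  rw [unitMeasure_apply]
  calc volume ({t | c < tailQuantile l t} ∩ Set.Ioo 0 1)
      ≤ volume (Set.Ioc 0 (l (Set.Ioi c)).toReal) := by
        refine measure_mono fun t ht => ⟨ht.2.1, ?_⟩
        exact (ENNReal.ofReal_le_iff_le_toReal (measure_ne_top _ _)).1
          (le_measure_Ioi_of_lt_tailQuantile hc ht.1)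
    _ = l (Set.Ioi c) := by simp

/-- Together with the previous bound: at levels where the tail has mass at most 1, the quantile
function on (0,1) is equidistributed with `l`. -/
theorem measure_Ioi_le_unitMeasure_lt_tailQuantile {c : ℝ} (h1 : l (Set.Ioi c) ≤ 1) :
    l (Set.Ioi c) ≤ unitMeasure {t | c < tailQuantile l t} := by
  rw [unitMeasure_apply]
  calc l (Set.Ioi c) = volume (Set.Ioo 0 (l (Set.Ioi c)).toReal) := by simp
    _ ≤ volume ({t | c < tailQuantile l t} ∩ Set.Ioo 0 1) := by
        refine measure_mono fun t ht => ⟨?_, ht.1, ?_⟩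
        · exact lt_tailQuantile_of_lt_measure_Ioi ht.1
            ((ENNReal.ofReal_lt_iff_lt_toReal ht.1.le (measure_ne_top _ _)).2 ht.2)
        · exact ht.2.trans_le (ENNReal.toReal_le_of_le_ofReal zero_le_one (by simpa using h1))

end

/-! ### Symmetric sequence spaces through counting functions -/

section

variable {𝕜 : Type*} [RCLike 𝕜]

/-- The number of entries of `a` of modulus larger than `c`. -/
noncomputable def tailCount (a : ℕ → 𝕜) (c : ℝ) : ℕ∞ := {k | c < ‖a k‖}.encard

theorem tailCount_mono {a b : ℕ → 𝕜} (h : ∀ k, ‖a k‖ ≤ ‖b k‖) (c : ℝ) :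
    tailCount a c ≤ tailCount b c :=
  Set.encard_le_encard fun k hk => lt_of_lt_of_le hk (h k)

namespace SymmSeqSpace

variable (E : SymmSeqSpace 𝕜)

/-- The symmetry axiom in terms of counting functions, in which all later comparisons are made.
Boundedness of `b` is automatic, since its count vanishes at a bound for `a`. -/
theorem mem_and_qnorm_le {a b : ℕ → 𝕜} (ha : a ∈ E.carrier)
    (h : ∀ c, 0 ≤ c → tailCount b c ≤ tailCount a c) : b ∈ E.carrier ∧ E.qnorm b ≤ E.qnorm a := by
  obtain ⟨C, hC⟩ := E.bounded a ha
  have hC0 : 0 ≤ C := (norm_nonneg _).trans (hC 0)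
  have ha0 : tailCount a C = 0 := by
    simp only [tailCount, Set.encard_eq_zero]
    exact Set.eq_empty_of_forall_notMem fun k hk => absurd (hC k) (not_le.2 hk)
  refine E.symm a ha b ⟨C, fun k => ?_⟩ fun n => ?_
  · by_contra! hk
    have hb0 : tailCount b C = 0 := le_antisymm ((h C hC0).trans_eq ha0) bot_le
    simp only [tailCount, Set.encard_eq_zero] at hb0
    exact Set.notMem_empty k (hb0 ▸ hk)
  · exact csInf_le_csInf ⟨0, fun _ hc => hc.1⟩ ⟨C, hC0, ha0.trans_le bot_le⟩
      fun c hc => ⟨hc.1, (h c hc.1).trans hc.2⟩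

theorem qnorm_eq_of_tailCount_eq {a b : ℕ → 𝕜} (ha : a ∈ E.carrier)
    (h : ∀ c, 0 ≤ c → tailCount b c = tailCount a c) : E.qnorm b = E.qnorm a := by
  obtain ⟨hb, hle⟩ := E.mem_and_qnorm_le ha fun c hc => (h c hc).le
  exact hle.antisymm (E.mem_and_qnorm_le hb fun c hc => (h c hc).ge).2

/-- Under a doubling of the counting function the quasi-norm grows at most by a constant factor. -/
theorem exists_qnorm_le_pow_mul : ∃ D : ℝ, 0 < D ∧ ∀ (r : ℕ) (a b : ℕ → 𝕜), a ∈ E.carrier →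
    (∀ c, 0 ≤ c → tailCount b c ≤ 2 ^ r * tailCount a c) →
    b ∈ E.carrier ∧ E.qnorm b ≤ D ^ r * E.qnorm a := by
  obtain ⟨C, hC, hadd⟩ := E.qnorm_add_le
  refine ⟨2 * C, by positivity, fun r => ?_⟩
  induction r with
  | zero => intro a b ha h; simpa using E.mem_and_qnorm_le ha (by simpa using h)
  | succ r ih =>
    intro a b ha h
    -- Copies of `a` on the even and on the odd places: each has the counting function of `a`, their
    -- sum has twice it.
    let e : ℕ → 𝕜 := fun k => if k % 2 = 0 then a (k / 2) else 0
    let o : ℕ → 𝕜 := fun k => if k % 2 = 1 then a (k / 2) else 0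
    have he : ∀ c, 0 ≤ c → tailCount e c ≤ tailCount a c := by
      intro c hc
      refine le_trans (Set.encard_le_encard ?_) (Set.encard_image_le (fun k => 2 * k) _)
      intro k hk
      by_cases hk2 : k % 2 = 0
      · exact ⟨k / 2, by simpa [e, hk2] using hk, by dsimp only; omega⟩
      · exact absurd hk (by simp [e, hk2, hc])
    have ho : ∀ c, 0 ≤ c → tailCount o c ≤ tailCount a c := by
      intro c hc
      refine le_trans (Set.encard_le_encard ?_) (Set.encard_image_le (fun k => 2 * k + 1) _)
      intro k hk
      by_cases hk2 : k % 2 = 1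
      · exact ⟨k / 2, by simpa [o, hk2] using hk, by dsimp only; omega⟩
      · have h0 : o k = 0 := if_neg hk2
        exact absurd hk (by simp [h0, hc])
    obtain ⟨he1, he2⟩ := E.mem_and_qnorm_le ha he
    obtain ⟨ho1, ho2⟩ := E.mem_and_qnorm_le ha ho
    have hsum : ∀ c, 0 ≤ c → 2 * tailCount a c ≤ tailCount (e + o) c := by
      intro c hc
      have hd : Disjoint ((fun k => 2 * k) '' {k | c < ‖a k‖})
          ((fun k => 2 * k + 1) '' {k | c < ‖a k‖}) := by
        rw [Set.disjoint_left]
        rintro _ ⟨i, -, rfl⟩ ⟨j, -, hj⟩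
        dsimp only at hj
        omega
      have hcard : ((fun k => 2 * k) '' {k | c < ‖a k‖} ∪
          (fun k => 2 * k + 1) '' {k | c < ‖a k‖}).encard = 2 * tailCount a c := by
        rw [Set.encard_union_eq hd, Function.Injective.encard_image (fun i j h => by simpa using h),
          Function.Injective.encard_image (fun i j h => by simpa using h), two_mul, tailCount]
      rw [← hcard]
      refine Set.encard_le_encard ?_
      rintro _ (⟨k, hk, rfl⟩ | ⟨k, hk, rfl⟩)
      · simpa [e, o] using hk
      · have h1 : (2 * k + 1) % 2 = 1 := by omega
        have h2 : (2 * k + 1) / 2 = k := by omega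
        simpa [e, o, h1, h2] using hk
    obtain ⟨hb1, hb2⟩ := ih (e + o) b (E.carrier.add_mem he1 ho1) fun c hc =>
      (h c hc).trans (by rw [pow_succ, mul_assoc]; gcongr; exact hsum c hc)
    refine ⟨hb1, hb2.trans ?_⟩
    calc (2 * C) ^ r * E.qnorm (e + o) ≤ (2 * C) ^ r * (C * (E.qnorm a + E.qnorm a)) := by
          gcongr
          exact (hadd e he1 o ho1).trans (by gcongr)
      _ = (2 * C) ^ (r + 1) * E.qnorm a := by ring

theorem tailCount_single (t : 𝕜) {c : ℝ} (hc : 0 ≤ c) (k : ℕ) :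
    tailCount (Pi.single k t) c = if c < ‖t‖ then 1 else 0 := by
  have : {i | c < ‖(Pi.single k t : ℕ → 𝕜) i‖} = if c < ‖t‖ then {k} else ∅ := by
    ext i
    by_cases hi : i = k
    · subst hi; by_cases h : c < ‖t‖ <;> simp [h]
    · by_cases h : c < ‖t‖ <;> simp [h, hi, hc]
  rw [tailCount, this]
  split_ifs <;> simp

theorem single_mem (t : 𝕜) (k : ℕ) : (Pi.single k t : ℕ → 𝕜) ∈ E.carrier := by
  obtain ⟨a, ha, ha0⟩ := E.nontrivial
  obtain ⟨i, hi⟩ := Function.ne_iff.1 ha0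
  have h1 : (Pi.single k (a i) : ℕ → 𝕜) ∈ E.carrier := by
    refine (E.mem_and_qnorm_le ha fun c hc => ?_).1
    rw [tailCount_single _ hc]
    split_ifs with h
    · exact Set.one_le_encard_iff_nonempty.2 ⟨i, h⟩
    · exact bot_le
  have h2 := E.carrier.smul_mem (t / a i) h1
  rwa [← Pi.single_smul, smul_eq_mul, div_mul_cancel₀ _ hi] at h2

theorem qnorm_single (t : 𝕜) (k : ℕ) :
    E.qnorm (Pi.single k t) = ‖t‖ * E.qnorm (Pi.single 0 1) := by
  rw [← E.qnorm_smul t _ (E.single_mem 1 0), ← Pi.single_smul, smul_eq_mul, mul_one]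
  exact E.qnorm_eq_of_tailCount_eq (E.single_mem t 0) fun c hc => by simp [tailCount_single, hc]

theorem qnorm_single_one_pos : 0 < E.qnorm (Pi.single 0 1) :=
  (E.qnorm_nonneg _ (E.single_mem 1 0)).lt_of_ne fun h => by
    simpa using (E.qnorm_eq_zero_iff _ (E.single_mem 1 0)).1 h.symm

theorem tailCount_extendZero {n : ℕ} (x : Fin n → 𝕜) {c : ℝ} (hc : 0 ≤ c) :
    tailCount (extendZero x) c = ((Finset.univ.filter fun k => c < ‖x k‖).card : ℕ∞) := by
  have : {k | c < ‖extendZero x k‖} =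
      ((Finset.univ.filter fun k => c < ‖x k‖).map Fin.valEmbedding : Finset ℕ) := by
    ext k
    by_cases hk : k < n
    · simp only [extendZero, hk, dite_true, Set.mem_ofPred_eq, Finset.coe_map, Set.mem_image,
        Finset.coe_filter, Finset.mem_univ, true_and, Fin.valEmbedding_apply]
      exact ⟨fun h => ⟨⟨k, hk⟩, h, rfl⟩, by rintro ⟨i, h, rfl⟩; exact h⟩
    · simp only [extendZero, hk, dite_false, norm_zero, Set.mem_ofPred_eq, Finset.coe_map,
        Set.mem_image, Finset.coe_filter, Finset.mem_univ, true_and, Fin.valEmbedding_apply]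
      exact ⟨fun h => absurd h (not_lt.2 hc), by rintro ⟨i, -, rfl⟩; exact absurd i.2 hk⟩
  rw [tailCount, this, Set.encard_coe_eq_coe_finsetCard, Finset.card_map]

theorem extendZero_mem {n : ℕ} (x : Fin n → 𝕜) : extendZero x ∈ E.carrier := by
  have : extendZero x = ∑ k : Fin n, (Pi.single (k : ℕ) (x k) : ℕ → 𝕜) := by
    ext i
    rw [Finset.sum_apply]
    by_cases hi : i < n
    · rw [Finset.sum_eq_single ⟨i, hi⟩]
      · simp [extendZero, hi]
      · intro k _ hk
        rw [Pi.single_eq_of_ne]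
        rintro rfl
        exact hk rfl
      · simp
    · rw [Finset.sum_eq_zero]
      · simp [extendZero, hi]
      · intro k _
        rw [Pi.single_eq_of_ne]
        rintro rfl
        exact hi k.2
  rw [this]
  exact E.carrier.sum_mem fun k _ => E.single_mem _ _

/-- The quasi-norm of a finite sequence of real numbers. -/
noncomputable def finNorm {n : ℕ} (x : Fin n → ℝ) : ℝ := E.qnorm (extendZero fun k => (x k : 𝕜))

theorem finNorm_nonneg {n : ℕ} (x : Fin n → ℝ) : 0 ≤ E.finNorm x :=
  E.qnorm_nonneg _ (E.extendZero_mem _)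

theorem finNorm_mono {n : ℕ} {x y : Fin n → ℝ} (h : ∀ k, |x k| ≤ |y k|) :
    E.finNorm x ≤ E.finNorm y := by
  refine (E.mem_and_qnorm_le (E.extendZero_mem _) fun c hc => tailCount_mono (fun k => ?_) c).2
  by_cases hk : k < n
  · simpa [extendZero, hk] using h ⟨k, hk⟩
  · simp [extendZero, hk]

theorem qnorm_extendZero {n : ℕ} (x : Fin n → 𝕜) :
    E.qnorm (extendZero x) = E.finNorm fun k => ‖x k‖ :=
  E.qnorm_eq_of_tailCount_eq (E.extendZero_mem _) fun c hc => by
    simp [tailCount_extendZero _ hc]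

theorem finNorm_smul {n : ℕ} {s : ℝ} (hs : 0 ≤ s) (x : Fin n → ℝ) :
    E.finNorm (fun k => s * x k) = s * E.finNorm x := by
  have h := E.qnorm_smul (s : 𝕜) _ (E.extendZero_mem fun k => (x k : 𝕜))
  rw [RCLike.norm_ofReal, abs_of_nonneg hs] at h
  rw [finNorm, finNorm, ← h]
  congr 1
  ext k
  by_cases hk : k < n <;> simp [extendZero, hk]

theorem le_finNorm {n : ℕ} (x : Fin n → ℝ) (k : Fin n) :
    |x k| * E.qnorm (Pi.single 0 1) ≤ E.finNorm x := by
  have h := E.qnorm_single (x k : 𝕜) 0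
  rw [RCLike.norm_ofReal] at h
  rw [← h]
  refine (E.mem_and_qnorm_le (E.extendZero_mem _) fun c hc => ?_).2
  rw [tailCount_single _ hc]
  split_ifs with h
  · exact Set.one_le_encard_iff_nonempty.2 ⟨k, by simpa [extendZero] using h⟩
  · exact bot_le

/-- A sublevel set is a countable union of boxes with rational corners. Monotonicity and homogeneity
suffice: if ‖x‖ < a, then ‖s·x‖ < a for some s > 1, leaving room for a rational vector between |x|
and s|x|. Continuity of the quasi-norm is not used. -/
theorem measurable_finNorm {n : ℕ} : Measurable (E.finNorm : (Fin n → ℝ) → ℝ) := by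
  refine measurable_of_Iio fun a => ?_
  have : E.finNorm ⁻¹' Set.Iio a = ⋃ r : {r : Fin n → ℚ // E.finNorm (fun k => (r k : ℝ)) < a},
      {x : Fin n → ℝ | ∀ k, |x k| ≤ |((r : Fin n → ℚ) k : ℝ)|} := by
    ext x
    simp only [Set.mem_preimage, Set.mem_Iio, Set.mem_iUnion, Set.mem_ofPred_eq]
    constructor
    · intro hx
      obtain ⟨s, hs1, hs⟩ : ∃ s : ℝ, 1 < s ∧ s * E.finNorm x < a := by
        have hcont : Tendsto (fun s : ℝ => s * E.finNorm x) (𝓝[>] 1) (𝓝 (1 * E.finNorm x)) :=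
          (by fun_prop : Continuous fun s : ℝ => s * E.finNorm x).continuousWithinAt
        obtain ⟨s, h1, h2⟩ := ((hcont.eventually_lt_const (by simpa using hx)).and
          self_mem_nhdsWithin).exists
        exact ⟨s, h2, h1⟩
      have hr : ∀ k, ∃ r : ℚ, |x k| ≤ |(r : ℝ)| ∧ |(r : ℝ)| ≤ |s * x k| := by
        intro k
        rcases eq_or_ne (x k) 0 with h | h
        · exact ⟨0, by simp [h]⟩
        · have hpos : 0 < |x k| := abs_pos.2 h
          obtain ⟨r, hr1, hr2⟩ := exists_rat_btwn (show |x k| < s * |x k| by nlinarith)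
          have hr0 : (0 : ℝ) ≤ r := hpos.le.trans hr1.le
          refine ⟨r, ?_, ?_⟩ <;> rw [abs_of_nonneg hr0]
          · exact hr1.le
          · rw [abs_mul, abs_of_pos (zero_lt_one.trans hs1)]
            exact hr2.le
      choose r hr1 hr2 using hr
      refine ⟨⟨r, ((E.finNorm_mono hr2).trans_eq ?_).trans_lt hs⟩, hr1⟩
      exact E.finNorm_smul (by linarith) x
    · rintro ⟨⟨r, hr⟩, h⟩
      exact (E.finNorm_mono h).trans_lt hr
  rw [this]
  refine MeasurableSet.iUnion fun r => ?_
  rw [Set.ofPred_forall]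
  exact MeasurableSet.iInter fun k =>
    measurableSet_le (measurable_pi_apply k).abs measurable_const

/-! ### The modular of the quasi-norm -/

/-- The modular `Φ(‖a‖_E)`. -/
noncomputable def modular (Φ : ℝ → ℝ) (a : ℕ → 𝕜) : ℝ≥0∞ := ENNReal.ofReal (Φ (E.qnorm a))

/-- `K` is an admissible constant for the quasi-norm of `E` and the function `Φ`. -/
structure IsModularConst (Φ : ℝ → ℝ) (K : ℕ) : Prop where
  three_le : 3 ≤ K
  modular_le : ∀ (r : ℕ) (a b : ℕ → 𝕜), a ∈ E.carrier →
    (∀ c, 0 ≤ c → tailCount b c ≤ 2 ^ r * tailCount a c) →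
    E.modular Φ b ≤ K ^ r * E.modular Φ a
  modular_add_le : ∀ a ∈ E.carrier, ∀ b ∈ E.carrier,
    E.modular Φ (a + b) ≤ K * (E.modular Φ a + E.modular Φ b)
  modular_single_le : ∀ (t : ℝ) (k : ℕ), 0 ≤ t →
    E.modular Φ (Pi.single k (t : 𝕜)) ≤ K * ENNReal.ofReal (Φ t)
  le_modular : ∀ (s : ℝ), 0 ≤ s →
    ENNReal.ofReal (Φ (s / E.qnorm (Pi.single 0 1))) ≤ K * ENNReal.ofReal (Φ s)

/-- By Δ₂, each constant factor lost inside Φ becomes a constant factor outside. One natural number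
serves for all of them, as it will be both a base and an exponent; `3 ≤ K` is there to give e ≤ K.
-/
theorem exists_isModularConst {Φ : ℝ → ℝ} (hΦ : IsOrlicz Φ) (hΔ : DeltaTwo Φ) :
    ∃ K : ℕ, E.IsModularConst Φ K := by
  obtain ⟨D, hD, hdil⟩ := E.exists_qnorm_le_pow_mul
  obtain ⟨C, hC, hadd⟩ := E.qnorm_add_le
  set θ := E.qnorm (Pi.single 0 1)
  have hθ : 0 < θ := E.qnorm_single_one_pos
  obtain ⟨K₁, hK₁1, hK₁⟩ := hΔ.exists_mul_le hΦ hD.le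
  obtain ⟨K₂, hK₂1, hK₂⟩ := hΔ.exists_mul_le hΦ (show 0 ≤ C * 2 by positivity)
  obtain ⟨K₃, hK₃1, hK₃⟩ := hΔ.exists_mul_le hΦ hθ.le
  obtain ⟨K₄, hK₄1, hK₄⟩ := hΔ.exists_mul_le hΦ (inv_nonneg.2 hθ.le)
  obtain ⟨K, hK⟩ := exists_nat_ge (max (max K₁ K₂) (max (max K₃ K₄) 3))
  simp only [max_le_iff] at hK
  obtain ⟨⟨h1, h2⟩, ⟨h3, h4⟩, h5⟩ := hK
  have key : ∀ {κ u v : ℝ}, κ ≤ K → 0 ≤ v → Φ u ≤ κ * Φ v →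
      ENNReal.ofReal (Φ u) ≤ K * ENNReal.ofReal (Φ v) := by
    intro κ u v hκ hv h
    rw [← ENNReal.ofReal_natCast, ← ENNReal.ofReal_mul (by positivity)]
    exact ENNReal.ofReal_le_ofReal
      (h.trans (mul_le_mul_of_nonneg_right hκ (hΦ.nonneg hv)))
  refine ⟨K, by exact_mod_cast h5, ?_, ?_, ?_, ?_⟩
  · intro r a b ha h
    obtain ⟨hb, hle⟩ := hdil r a b ha h
    have hq := E.qnorm_nonneg a ha
    have hpow : ∀ r : ℕ, ∀ t : ℝ, 0 ≤ t →
        ENNReal.ofReal (Φ (D ^ r * t)) ≤ K ^ r * ENNReal.ofReal (Φ t) := by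
      intro r
      induction r with
      | zero => simp
      | succ r ih =>
        intro t ht
        rw [pow_succ', mul_assoc, pow_succ', mul_assoc]
        refine (key h1 (by positivity) (hK₁ _ (by positivity))).trans ?_
        gcongr
        exact ih t ht
    exact (ENNReal.ofReal_le_ofReal (hΦ.mono (E.qnorm_nonneg b hb) hle)).trans (hpow r _ hq)
  · intro a ha b hb
    have hqa := E.qnorm_nonneg a ha
    have hqb := E.qnorm_nonneg b hb
    have hmax : 0 ≤ max (E.qnorm a) (E.qnorm b) := le_max_of_le_left hqa
    have hle : E.qnorm (a + b) ≤ C * 2 * max (E.qnorm a) (E.qnorm b) := by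
      refine (hadd a ha b hb).trans ?_
      rw [mul_assoc]
      gcongr
      linarith [le_max_left (E.qnorm a) (E.qnorm b), le_max_right (E.qnorm a) (E.qnorm b)]
    refine (key h2 hmax ((hΦ.mono (E.qnorm_nonneg _ (E.carrier.add_mem ha hb)) hle).trans
      (hK₂ _ hmax))).trans ?_
    gcongr
    rcases max_choice (E.qnorm a) (E.qnorm b) with h | h <;> rw [h]
    · exact le_self_add
    · exact le_add_self
  · intro t k ht
    rw [modular, qnorm_single, RCLike.norm_ofReal, abs_of_nonneg ht, mul_comm]
    exact key h3 ht (hK₃ t ht)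
  · intro s hs
    rw [div_eq_inv_mul]
    exact key h4 hs (hK₄ s hs)

end SymmSeqSpace

/-- The sequence `(0, a 0, a 1, …)`. -/
def shiftRight (a : ℕ → 𝕜) : ℕ → 𝕜 := fun k => if k = 0 then 0 else a (k - 1)

theorem tailCount_shiftRight_le (a : ℕ → 𝕜) {c : ℝ} (hc : 0 ≤ c) :
    tailCount (shiftRight a) c ≤ tailCount a c := by
  refine le_trans (Set.encard_le_encard fun k hk => ?_) (Set.encard_image_le (fun k => k + 1) _)
  rcases k with _ | k
  · exact absurd hk (by simp [shiftRight, hc])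
  · exact ⟨k, by simpa [shiftRight] using hk, rfl⟩

/-- The shift frees place 0 for an additional entry, so the counts add. -/
theorem le_tailCount_single_add_shiftRight (t : 𝕜) (a : ℕ → 𝕜) (c : ℝ) :
    (if c < ‖t‖ then 1 else 0) + tailCount a c ≤ tailCount (Pi.single 0 t + shiftRight a) c := by
  have hcard : ((if c < ‖t‖ then {0} else ∅ : Set ℕ) ∪ (fun k => k + 1) '' {k | c < ‖a k‖}).encard
      = (if c < ‖t‖ then 1 else 0) + tailCount a c := by
    rw [Set.encard_union_eq, Function.Injective.encard_image (fun i j h => by simpa using h),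
      tailCount]
    · split_ifs <;> simp
    · rw [Set.disjoint_left]
      rintro k hk ⟨j, -, rfl⟩
      split_ifs at hk <;> simp at hk
  rw [← hcard]
  refine Set.encard_le_encard ?_
  rintro k (hk | ⟨k, hk, rfl⟩)
  · split_ifs at hk with h
    · simp only [Set.mem_singleton_iff] at hk
      subst hk
      simpa [shiftRight] using h
    · exact absurd hk (Set.notMem_empty k)
  · simpa [shiftRight] using hk

end

/-! ### Independent random variables -/

section

variable {Ω : Type*} {n : ℕ}

open Classical in
/-- The number of the random variables `X k` with value in `S`. -/
noncomputable def hitCount (X : Fin n → Ω → ℝ) (S : Set ℝ) (ω : Ω) : ℕ :=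
  (Finset.univ.filter fun k => X k ω ∈ S).card

theorem hitCount_mono (X : Fin n → Ω → ℝ) {S T : Set ℝ} (h : S ⊆ T) (ω : Ω) :
    hitCount X S ω ≤ hitCount X T ω := by
  classical
  exact Finset.card_le_card (Finset.monotone_filter_right _ fun _ _ hk => h hk)

open Classical in
theorem hitCount_le (X : Fin n → Ω → ℝ) (S : Set ℝ) (ω : Ω) : hitCount X S ω ≤ n :=
  (Finset.card_filter_le _ _).trans (by simp)

open Classical in
theorem pow_hitCount (X : Fin n → Ω → ℝ) (A : ℝ≥0∞) (S : Set ℝ) (ω : Ω) :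
    A ^ hitCount X S ω = ∏ k, if X k ω ∈ S then A else 1 := by
  simp [hitCount, Finset.prod_ite]

variable [MeasurableSpace Ω]

/-- The law of the disjoint sum of the random variables `X k`. -/
noncomputable def sumLaw (P : Measure Ω) (X : Fin n → Ω → ℝ) : Measure ℝ := ∑ k, P.map (X k)

variable {X : Fin n → Ω → ℝ}

theorem measurable_pow_hitCount (hX : ∀ k, Measurable (X k)) (A : ℝ≥0∞) {S : Set ℝ}
    (hS : MeasurableSet S) : Measurable fun ω => A ^ hitCount X S ω := by
  classical
  simp only [pow_hitCount]
  exact Finset.measurable_prod _ fun k _ =>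
    Measurable.ite (hX k hS) measurable_const measurable_const

variable {P : Measure Ω}

theorem sumLaw_apply (hX : ∀ k, Measurable (X k)) {S : Set ℝ} (hS : MeasurableSet S) :
    sumLaw P X S = ∑ k, P (X k ⁻¹' S) := by
  simp only [sumLaw, Measure.finsetSum_apply]
  exact Finset.sum_congr rfl fun k _ => Measure.map_apply (hX k) hS

theorem lintegral_sumLaw (hX : ∀ k, Measurable (X k)) {φ : ℝ → ℝ≥0∞} (hφ : Measurable φ) :
    ∫⁻ x, φ x ∂(sumLaw P X) = ∑ k, ∫⁻ ω, φ (X k ω) ∂P := by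
  simp only [sumLaw, lintegral_finsetSum_measure]
  exact Finset.sum_congr rfl fun k _ => lintegral_map hφ (hX k)

variable [IsProbabilityMeasure P]

instance isFiniteMeasure_sumLaw : IsFiniteMeasure (sumLaw P X) := by
  unfold sumLaw; infer_instance

theorem sumLaw_real (hX : ∀ k, Measurable (X k)) {S : Set ℝ} (hS : MeasurableSet S) :
    (sumLaw P X).real S = ∑ k, P.real (X k ⁻¹' S) := by
  simp only [Measure.real]
  rw [sumLaw_apply hX hS, ENNReal.toReal_sum fun k _ => measure_ne_top _ _]

theorem sumLaw_le (hX : ∀ k, Measurable (X k)) {S : Set ℝ} (hS : MeasurableSet S) :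
    sumLaw P X S ≤ n := by
  rw [sumLaw_apply hX hS]
  calc ∑ k, P (X k ⁻¹' S) ≤ ∑ _k : Fin n, (1 : ℝ≥0∞) := Finset.sum_le_sum fun k _ => prob_le_one
    _ = n := by simp

open Classical in
-- With p the probability of a hit, the integral is 1 + (a-1)p ≤ exp((a-1)p).
theorem lintegral_ite_le_exp (hX : ∀ k, Measurable (X k)) {S : Set ℝ} (hS : MeasurableSet S)
    {a : ℝ} (ha : 0 ≤ a) (k : Fin n) :
    ∫⁻ ω, (if X k ω ∈ S then ENNReal.ofReal a else 1) ∂P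
      ≤ ENNReal.ofReal (Real.exp ((a - 1) * P.real (X k ⁻¹' S))) := by
  have hB : MeasurableSet (X k ⁻¹' S) := hX k hS
  have hp1 : P.real (X k ⁻¹' S) ≤ 1 := measureReal_le_one
  rw [← lintegral_add_compl _ hB,
    setLIntegral_congr_fun (f := fun ω => if X k ω ∈ S then ENNReal.ofReal a else 1) hB
      (g := fun _ => ENNReal.ofReal a) (fun ω (hω : X k ω ∈ S) => if_pos hω),
    setLIntegral_congr_fun (f := fun ω => if X k ω ∈ S then ENNReal.ofReal a else 1) hB.compl
      (g := fun _ => 1) (fun ω (hω : X k ω ∉ S) => if_neg hω),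
    setLIntegral_const, setLIntegral_const, one_mul, ← ofReal_measureReal, ← ofReal_measureReal,
    ← ENNReal.ofReal_mul ha, probReal_compl_eq_one_sub hB,
    ← ENNReal.ofReal_add (by positivity) (by linarith)]
  refine ENNReal.ofReal_le_ofReal ?_
  linarith [Real.add_one_le_exp ((a - 1) * P.real (X k ⁻¹' S))]

/-- Exponential moments of the number of hits. -/
theorem lintegral_pow_hitCount_le (hX : ∀ k, Measurable (X k)) (hind : iIndepFun X P)
    {S : Set ℝ} (hS : MeasurableSet S) {a : ℝ} (ha : 0 ≤ a) :
    ∫⁻ ω, ENNReal.ofReal a ^ hitCount X S ω ∂P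
      ≤ ENNReal.ofReal (Real.exp ((a - 1) * (sumLaw P X).real S)) := by
  classical
  let g : ℝ → ℝ≥0∞ := fun x => if x ∈ S then ENNReal.ofReal a else 1
  have hg : Measurable g := Measurable.ite hS measurable_const measurable_const
  simp only [pow_hitCount]
  have h := lintegral_prod_eq_prod_lintegral_of_indepFun Finset.univ (fun k ω => g (X k ω))
    (hind.comp (fun _ => g) fun _ => hg) fun k => hg.comp (hX k)
  rw [h, sumLaw_real hX hS, Finset.mul_sum, Real.exp_sum,
    ENNReal.ofReal_prod_of_nonneg fun _ _ => (Real.exp_pos _).le]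
  exact Finset.prod_le_prod' fun k _ => lintegral_ite_le_exp hX hS ha k

theorem lintegral_pow_hitCount_mul_le (hX : ∀ k, Measurable (X k)) (hind : iIndepFun X P)
    {S : Set ℝ} (hS : MeasurableSet S) {a : ℝ} (ha : 1 ≤ a) {φ : ℝ → ℝ≥0∞} (hφ : Measurable φ)
    (k : Fin n) :
    ∫⁻ ω, ENNReal.ofReal a ^ hitCount X S ω * φ (X k ω) ∂P
      ≤ ENNReal.ofReal a * ENNReal.ofReal (Real.exp ((a - 1) * (sumLaw P X).real S)) *
        ∫⁻ ω, φ (X k ω) ∂P := by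
  classical
  have ha0 : 0 ≤ a := zero_le_one.trans ha
  -- The weight φ is attached to the factor of index `k`, so the integrand stays a product of
  -- functions of independent variables.
  let g : Fin n → ℝ → ℝ≥0∞ := fun i x =>
    (if x ∈ S then ENNReal.ofReal a else 1) * if i = k then φ x else 1
  have hg : ∀ i, Measurable (g i) := fun i => by
    refine (Measurable.ite hS measurable_const measurable_const).mul ?_
    split_ifs
    · exact hφ
    · exact measurable_const
  have h := lintegral_prod_eq_prod_lintegral_of_indepFun Finset.univ (fun i ω => g i (X i ω))
    (hind.comp g hg) fun i => (hg i).comp (hX i)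
  have hint : ∀ ω, ENNReal.ofReal a ^ hitCount X S ω * φ (X k ω) = ∏ i, g i (X i ω) := by
    intro ω
    simp only [g, Finset.prod_mul_distrib, pow_hitCount, Finset.prod_ite_eq', Finset.mem_univ,
      if_true]
  simp only [hint]
  rw [h, ← Finset.mul_prod_erase _ _ (Finset.mem_univ k)]
  have h1 : ∫⁻ ω, g k (X k ω) ∂P ≤ ENNReal.ofReal a * ∫⁻ ω, φ (X k ω) ∂P := by
    rw [← lintegral_const_mul' _ _ ENNReal.ofReal_ne_top]
    refine lintegral_mono fun ω => ?_
    simp only [g, if_true]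
    gcongr
    split_ifs
    · exact le_rfl
    · simpa using ha
  have h2 : ∏ i ∈ Finset.univ.erase k, ∫⁻ ω, g i (X i ω) ∂P
      ≤ ENNReal.ofReal (Real.exp ((a - 1) * (sumLaw P X).real S)) := by
    calc ∏ i ∈ Finset.univ.erase k, ∫⁻ ω, g i (X i ω) ∂P
        ≤ ∏ i ∈ Finset.univ.erase k,
          ENNReal.ofReal (Real.exp ((a - 1) * P.real (X i ⁻¹' S))) := by
          refine Finset.prod_le_prod' fun i hi => ?_
          simpa [g, Finset.ne_of_mem_erase hi] using lintegral_ite_le_exp (P := P) hX hS ha0 i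
      _ = ENNReal.ofReal (Real.exp (∑ i ∈ Finset.univ.erase k, (a - 1) * P.real (X i ⁻¹' S))) := by
          rw [Real.exp_sum, ENNReal.ofReal_prod_of_nonneg fun _ _ => (Real.exp_pos _).le]
      _ ≤ _ := by
          rw [sumLaw_real hX hS, Finset.mul_sum]
          refine ENNReal.ofReal_le_ofReal (Real.exp_le_exp.2 ?_)
          exact Finset.sum_le_sum_of_subset_of_nonneg (Finset.erase_subset _ _)
            fun i _ _ => mul_nonneg (by linarith) measureReal_nonneg
  calc _ ≤ (ENNReal.ofReal a * ∫⁻ ω, φ (X k ω) ∂P) *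
        ENNReal.ofReal (Real.exp ((a - 1) * (sumLaw P X).real S)) := mul_le_mul' h1 h2
    _ = _ := by ring

/-- The probability of at least one hit. -/
theorem min_sumLaw_one_le (hX : ∀ k, Measurable (X k)) (hind : iIndepFun X P)
    {S : Set ℝ} (hS : MeasurableSet S) :
    min (sumLaw P X S) 1 ≤ 2 * P {ω | ∃ k, X k ω ∈ S} := by
  set x := (sumLaw P X).real S
  have hx : 0 ≤ x := measureReal_nonneg
  have hB : MeasurableSet {ω | ∃ k, X k ω ∈ S} := by
    rw [Set.ofPred_exists]
    exact MeasurableSet.iUnion fun k => hX k hS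
  -- Base a = 0: the power 0^hits is the indicator of no hit.
  have h0 := lintegral_pow_hitCount_le hX hind hS le_rfl
  have hle : P {ω | ∃ k, X k ω ∈ S}ᶜ ≤ ENNReal.ofReal (Real.exp (-x)) := by
    refine le_trans ?_ (h0.trans_eq (by simp [x]))
    rw [← lintegral_indicator_one hB.compl]
    refine lintegral_mono fun ω => ?_
    by_cases h : ∃ k, X k ω ∈ S
    · simp [h]
    · have : hitCount X S ω = 0 := by
        simp only [hitCount, Finset.card_eq_zero, Finset.filter_eq_empty_iff]
        exact fun k _ hk => h ⟨k, hk⟩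
      simp [h, this]
  set p := P.real {ω | ∃ k, X k ω ∈ S}
  have hp : 1 - p ≤ Real.exp (-x) := by
    have := ENNReal.toReal_le_of_le_ofReal (Real.exp_pos _).le hle
    rwa [← Measure.real, probReal_compl_eq_one_sub hB] at this
  have hexp : Real.exp (-x) ≤ 1 / (1 + x) := by
    rw [Real.exp_neg, ← one_div]
    exact one_div_le_one_div_of_le (by linarith) (by linarith [Real.add_one_le_exp x])
  have hmin : min x 1 ≤ 2 * p := by
    have h3 : (1 - p) * (1 + x) ≤ 1 := by
      have := hp.trans hexp
      rwa [le_div_iff₀ (by linarith)] at this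
    have hp0 : 0 ≤ p := measureReal_nonneg
    rcases le_total x 1 with h | h
    · rw [min_eq_left h]
      nlinarith
    · rw [min_eq_right h]
      nlinarith
  rw [← ofReal_measureReal (μ := sumLaw P X), ← ofReal_measureReal (μ := P), ← ENNReal.ofReal_one,
    ← ENNReal.ofReal_min, show (2 : ℝ≥0∞) = ENNReal.ofReal 2 by simp,
    ← ENNReal.ofReal_mul (by norm_num)]
  exact ENNReal.ofReal_le_ofReal hmin

end

/-! ### The sequence of values of the rearrangement at the integers -/

section

variable (𝕜 : Type*) [RCLike 𝕜]

/-- The sequence `(μ(k))_{k ≥ 1}` of values of the decreasing rearrangement. -/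
noncomputable def quantileSeq (l : Measure ℝ) (k : ℕ) : 𝕜 := (tailQuantile l ((k : ℝ) + 1) : ℝ)

variable {𝕜} {l : Measure ℝ}

theorem norm_quantileSeq (k : ℕ) : ‖(quantileSeq 𝕜 l k : 𝕜)‖ = tailQuantile l ((k : ℝ) + 1) := by
  rw [quantileSeq, RCLike.norm_ofReal, abs_of_nonneg (tailQuantile_nonneg _ _)]

/-- Total mass at most n makes the quantiles vanish beyond n, so the truncated sequence of the
theorem loses nothing. -/
theorem extendZero_tailQuantile {n : ℕ} (hl : l (Set.Ioi 0) ≤ n) :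
    (extendZero fun k : Fin n => ((tailQuantile l ((k : ℝ) + 1) : ℝ) : 𝕜)) = quantileSeq 𝕜 l := by
  ext k
  by_cases hk : k < n
  · simp [extendZero, quantileSeq, hk]
  · have : tailQuantile l ((k : ℝ) + 1) = 0 := by
      by_contra hne
      have h1 := (le_measure_Ioi_of_lt_tailQuantile le_rfl
        ((tailQuantile_nonneg l _).lt_of_ne' hne)).trans hl
      rw [← ENNReal.ofReal_natCast, ENNReal.ofReal_le_ofReal_iff (by positivity)] at h1
      have : (n : ℝ) ≤ k := by exact_mod_cast not_lt.1 hk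
      linarith
    simp [extendZero, quantileSeq, hk, this]

variable [IsFiniteMeasure l]

theorem exists_tailCount_quantileSeq {c : ℝ} (hc : 0 ≤ c) :
    ∃ κ : ℕ, tailCount (quantileSeq 𝕜 l) c = κ ∧
      ∀ k : ℕ, c < tailQuantile l ((k : ℝ) + 1) ↔ k < κ := by
  classical
  have hex : ∃ k : ℕ, ¬ c < tailQuantile l ((k : ℝ) + 1) := by
    obtain ⟨k, hk⟩ := exists_nat_gt (l.real (Set.Ioi c))
    refine ⟨k, fun h => ?_⟩
    have := ENNReal.toReal_mono (measure_ne_top _ _) (le_measure_Ioi_of_lt_tailQuantile hc h)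
    rw [ENNReal.toReal_ofReal (by positivity), ← Measure.real] at this
    linarith
  obtain ⟨κ, hκ, hmin⟩ : ∃ κ : ℕ, ¬ c < tailQuantile l ((κ : ℝ) + 1) ∧
      ∀ j < κ, c < tailQuantile l ((j : ℝ) + 1) :=
    ⟨Nat.find hex, Nat.find_spec hex, fun j hj => not_not.1 (Nat.find_min hex hj)⟩
  have hiff : ∀ k : ℕ, c < tailQuantile l ((k : ℝ) + 1) ↔ k < κ := by
    intro k
    refine ⟨fun h => ?_, hmin k⟩
    by_contra! hk
    have hk' : (κ : ℝ) ≤ k := by exact_mod_cast hk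
    refine hκ (h.trans_le (tailQuantile_antitoneOn l (Set.mem_Ioi.2 ?_) (Set.mem_Ioi.2 ?_)
      (by linarith))) <;> positivity
  refine ⟨κ, ?_, hiff⟩
  have : {k | c < ‖(quantileSeq 𝕜 l k : 𝕜)‖} = (Finset.range κ : Set ℕ) := by
    ext k
    rw [Set.mem_ofPred_eq, norm_quantileSeq, hiff, Finset.coe_range, Set.mem_Iio]
  rw [tailCount, this, Set.encard_coe_eq_coe_finsetCard, Finset.card_range]

theorem IsOrlicz.ofReal_tailQuantile_one_le {Φ : ℝ → ℝ} (hΦ : IsOrlicz Φ) :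
    ENNReal.ofReal (Φ (tailQuantile l 1)) ≤
      ∫⁻ t, ENNReal.ofReal (Φ (tailQuantile l t)) ∂unitMeasure := by
  calc ENNReal.ofReal (Φ (tailQuantile l 1))
      = ∫⁻ _, ENNReal.ofReal (Φ (tailQuantile l 1)) ∂unitMeasure := by simp
    _ ≤ _ := setLIntegral_mono' measurableSet_Ioo fun t ht =>
        ENNReal.ofReal_le_ofReal (hΦ.mono (tailQuantile_nonneg _ _)
          (tailQuantile_antitoneOn l (Set.mem_Ioi.2 ht.1) (Set.mem_Ioi.2 one_pos) ht.2.le))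

end

/-! ### The two-sided estimate -/

section

variable {𝕜 : Type*} [RCLike 𝕜] {Φ : ℝ → ℝ} {E : SymmSeqSpace 𝕜} {K : ℕ}
  {Ω : Type*} {n : ℕ} {X : Fin n → Ω → ℝ}

theorem tailCount_extendZero_ofReal (hX0 : ∀ k ω, 0 ≤ X k ω) (ω : Ω) {c : ℝ} (hc : 0 ≤ c) :
    tailCount (extendZero fun k => (X k ω : 𝕜)) c = hitCount X (Set.Ioi c) ω := by
  classical
  rw [SymmSeqSpace.tailCount_extendZero _ hc, hitCount]
  congr 2
  ext k
  simp [abs_of_nonneg (hX0 k ω)]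

variable [MeasurableSpace Ω] {P : Measure Ω} [IsProbabilityMeasure P]

/-- Needed only for finiteness of the integral of Φ(μ(t,f)). -/
theorem lintegral_tailQuantile_le_sum (hΦ : IsOrlicz Φ) (hX : ∀ k, Measurable (X k))
    (hX0 : ∀ k ω, 0 ≤ X k ω) :
    ∫⁻ t, ENNReal.ofReal (Φ (tailQuantile (sumLaw P X) t)) ∂unitMeasure
      ≤ ∑ k, ∫⁻ ω, ENNReal.ofReal (Φ (X k ω)) ∂P := by
  have h := hΦ.lintegral_le_of_tail (μ := sumLaw P X) (X := fun x => max x 0) (κ := 1)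
    (by fun_prop) (aemeasurable_tailQuantile (sumLaw P X)) (fun x => le_max_right _ _)
    (tailQuantile_nonneg _) ENNReal.one_ne_top fun c hc => by
      rw [one_mul]
      refine (unitMeasure_lt_tailQuantile_le hc).trans (measure_mono fun x hx => ?_)
      exact lt_max_of_lt_left (Set.mem_Ioi.1 hx)
  rw [one_mul, lintegral_sumLaw hX hΦ.continuous_max.measurable.ennreal_ofReal] at h
  simpa only [max_eq_left (hX0 _ _)] using h

theorem SymmSeqSpace.IsModularConst.lintegral_tailQuantile_le (hK : E.IsModularConst Φ K)
    (hΦ : IsOrlicz Φ) (hX : ∀ k, Measurable (X k)) (hind : iIndepFun X P) :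
    ∫⁻ t, ENNReal.ofReal (Φ (tailQuantile (sumLaw P X) t)) ∂unitMeasure
      ≤ 2 * K * ∫⁻ ω, ENNReal.ofReal (Φ (E.finNorm fun k => X k ω)) ∂P := by
  set θ := E.qnorm (Pi.single 0 1)
  have hθ : 0 < θ := E.qnorm_single_one_pos
  have hmeas : Measurable fun ω => E.finNorm fun k => X k ω :=
    E.measurable_finNorm.comp (measurable_pi_lambda _ hX)
  have h := hΦ.lintegral_le_of_tail (μ := P) (X := fun ω => (E.finNorm fun k => X k ω) / θ)
    (κ := 2) (hmeas.div_const θ).aemeasurable (aemeasurable_tailQuantile (sumLaw P X))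
    (fun ω => div_nonneg (E.finNorm_nonneg _) hθ.le) (tailQuantile_nonneg _)
    ENNReal.ofNat_ne_top fun c hc => by
      calc _ ≤ min (sumLaw P X (Set.Ioi c)) 1 :=
            le_min (unitMeasure_lt_tailQuantile_le hc) prob_le_one
        _ ≤ 2 * P {ω | ∃ k, X k ω ∈ Set.Ioi c} := min_sumLaw_one_le hX hind measurableSet_Ioi
        _ ≤ _ := by
            refine mul_le_mul_right (measure_mono ?_) 2
            rintro ω ⟨k, hk⟩
            show c < (E.finNorm fun k => X k ω) / θ
            rw [lt_div_iff₀ hθ]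
            have h1 := E.le_finNorm (fun k => X k ω) k
            have h2 : c < |X k ω| := lt_of_lt_of_le hk (le_abs_self _)
            exact (mul_lt_mul_of_pos_right h2 hθ).trans_le h1
  refine h.trans ?_
  rw [mul_assoc, ← lintegral_const_mul' _ _ (ENNReal.natCast_ne_top K)]
  gcongr
  exact hK.le_modular _ (E.finNorm_nonneg _)

/-- Write e⁻¹ ≤ 3/8 = (1/2)(3/4) and use (3/4)^8 ≤ 1/4. The first factor pays for Markov's
inequality; the second is summable with sum 1/3 < 1/2, which is why the levels start at 16. -/
theorem two_pow_level_bound (i : ℕ) :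
    Real.exp (-(2 ^ (i + 3) : ℝ)) ≤ (1 / 2) ^ (2 ^ (i + 3)) * (1 / 4) ^ (i + 1) := by
  have h1 : Real.exp (-1) ≤ 3 / 8 := by
    rw [Real.exp_neg, inv_le_comm₀ (Real.exp_pos _) (by norm_num)]
    have := Real.exp_one_gt_d9
    norm_num
    linarith
  have h2 : Real.exp (-(2 ^ (i + 3) : ℝ)) = Real.exp (-1) ^ (2 ^ (i + 3)) := by
    rw [← Real.exp_nat_mul]
    push_cast
    ring_nf
  rw [h2]
  calc Real.exp (-1) ^ (2 ^ (i + 3)) ≤ (3 / 8) ^ (2 ^ (i + 3)) := by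
        gcongr
    _ = (1 / 2) ^ (2 ^ (i + 3)) * (((3 / 4) ^ 8) ^ 2 ^ i : ℝ) := by
        rw [← pow_mul, show 8 * 2 ^ i = 2 ^ (i + 3) by ring, ← mul_pow]
        norm_num
    _ ≤ (1 / 2) ^ (2 ^ (i + 3)) * ((1 / 4) ^ 2 ^ i : ℝ) := by
        gcongr
        norm_num
    _ ≤ (1 / 2) ^ (2 ^ (i + 3)) * (1 / 4) ^ (i + 1) := by
        gcongr ?_ * ?_
        exact pow_le_pow_of_le_one (by norm_num) (by norm_num) Nat.lt_two_pow_self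

/-- With large probability the number of variables above the quantiles at dyadic levels is at
least half the expected one. -/
theorem measure_hitCount_lt_le (hX : ∀ k, Measurable (X k)) (hind : iIndepFun X P) (i : ℕ) :
    P {ω | 0 < tailQuantile (sumLaw P X) (2 ^ (i + 4)) ∧
        hitCount X (Set.Ici (tailQuantile (sumLaw P X) (2 ^ (i + 4)))) ω < 2 ^ (i + 3)}
      ≤ ENNReal.ofReal ((1 / 4) ^ (i + 1)) := by
  set m := tailQuantile (sumLaw P X) (2 ^ (i + 4))
  by_cases hm : 0 < m
  swap
  · simp [hm]
  have hreal : (2 : ℝ) ^ (i + 4) ≤ (sumLaw P X).real (Set.Ici m) := by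
    have := ENNReal.toReal_mono (measure_ne_top _ _) (le_measure_Ici_tailQuantile hm)
    rwa [ENNReal.toReal_ofReal (by positivity)] at this
  -- Chernoff with base 1/2: too few hits means (1/2)^hits ≥ ε.
  set ε : ℝ≥0∞ := ENNReal.ofReal (1 / 2) ^ (2 ^ (i + 3))
  have hmarkov := mul_meas_ge_le_lintegral (μ := P)
    (measurable_pow_hitCount hX (ENNReal.ofReal (1 / 2)) (measurableSet_Ici (a := m))) ε
  have hsub : {ω | 0 < m ∧ hitCount X (Set.Ici m) ω < 2 ^ (i + 3)} ⊆
      {ω | ε ≤ ENNReal.ofReal (1 / 2) ^ hitCount X (Set.Ici m) ω} := fun ω hω =>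
    pow_le_pow_right_of_le_one' (ENNReal.ofReal_le_one.2 (by norm_num)) hω.2.le
  have hle : ε * P {ω | 0 < m ∧ hitCount X (Set.Ici m) ω < 2 ^ (i + 3)}
      ≤ ε * ENNReal.ofReal ((1 / 4) ^ (i + 1)) := by
    calc _ ≤ ε * P {ω | ε ≤ ENNReal.ofReal (1 / 2) ^ hitCount X (Set.Ici m) ω} := by gcongr
      _ ≤ ENNReal.ofReal (Real.exp ((1 / 2 - 1) * (sumLaw P X).real (Set.Ici m))) :=
          hmarkov.trans (lintegral_pow_hitCount_le hX hind measurableSet_Ici (by norm_num))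
      _ ≤ ENNReal.ofReal ((1 / 2) ^ (2 ^ (i + 3)) * (1 / 4) ^ (i + 1)) := by
          refine ENNReal.ofReal_le_ofReal (le_trans (Real.exp_le_exp.2 ?_) (two_pow_level_bound i))
          have : (2 : ℝ) ^ (i + 4) = 2 * 2 ^ (i + 3) := by ring
          linarith
      _ = ε * ENNReal.ofReal ((1 / 4) ^ (i + 1)) := by
          rw [ENNReal.ofReal_mul (by positivity), ENNReal.ofReal_pow (by norm_num)]
  have hε0 : ε ≠ 0 := pow_ne_zero _ (by simp)
  have hεt : ε ≠ ⊤ := ENNReal.pow_ne_top ENNReal.ofReal_ne_top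
  exact (ENNReal.mul_le_mul_iff_right hε0 hεt).1 hle

/-- Dyadic levels control all levels up to a factor 2. A count κ below 16 is paid for by the
prepended entry μ(1,f); otherwise κ < 2^(i+5) = 4·2^(i+3), at most four times the number of hits. -/
theorem tailCount_quantileSeq_le_of_hitCount (hX0 : ∀ k ω, 0 ≤ X k ω) {ω : Ω}
    (hω : ∀ i : ℕ, 0 < tailQuantile (sumLaw P X) (2 ^ (i + 4)) →
      2 ^ (i + 3) ≤ hitCount X (Set.Ici (tailQuantile (sumLaw P X) (2 ^ (i + 4)))) ω)
    {c : ℝ} (hc : 0 ≤ c) :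
    tailCount (quantileSeq 𝕜 (sumLaw P X)) c ≤
      2 ^ 4 * tailCount (Pi.single 0 ((tailQuantile (sumLaw P X) 1 : ℝ) : 𝕜) +
        shiftRight (extendZero fun k => (X k ω : 𝕜))) c := by
  set l := sumLaw P X
  have hm : 0 ≤ tailQuantile l 1 := tailQuantile_nonneg _ _
  obtain ⟨κ, hκ, hiff⟩ := exists_tailCount_quantileSeq (𝕜 := 𝕜) (l := l) hc
  refine le_trans ?_ (mul_le_mul_right (le_tailCount_single_add_shiftRight
    ((tailQuantile l 1 : ℝ) : 𝕜) (extendZero fun k => (X k ω : 𝕜)) c) (2 ^ 4))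
  rw [tailCount_extendZero_ofReal hX0 ω hc, hκ, RCLike.norm_ofReal, abs_of_nonneg hm]
  rcases Nat.eq_zero_or_pos κ with rfl | hpos
  · simp
  have hcm : c < tailQuantile l 1 := by simpa using (hiff 0).2 hpos
  rw [if_pos hcm]
  suffices κ ≤ 2 ^ 4 * (1 + hitCount X (Set.Ioi c) ω) by exact_mod_cast this
  by_cases hκ16 : κ < 16
  · omega
  obtain ⟨i, hi⟩ : ∃ i, Nat.log 2 κ = i + 4 :=
    ⟨Nat.log 2 κ - 4, (Nat.sub_add_cancel
      (Nat.le_log_of_pow_le (by norm_num) (by omega))).symm⟩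
  have hlow : 2 ^ (i + 4) ≤ κ := hi ▸ Nat.pow_log_le_self 2 (by omega)
  have hup : κ < 2 ^ (i + 4 + 1) := hi ▸ Nat.lt_pow_succ_log_self (by norm_num) κ
  have hq : c < tailQuantile l (2 ^ (i + 4)) := by
    have hp : 0 < 2 ^ (i + 4) := by positivity
    -- The sequence starts at μ(1,f), so μ(2^(i+4),f) has index 2^(i+4) - 1.
    have := (hiff (2 ^ (i + 4) - 1)).2 (by omega)
    rwa [Nat.cast_sub (by omega), Nat.cast_one, sub_add_cancel, Nat.cast_pow,
      Nat.cast_ofNat] at this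
  have h1 := hω i (hc.trans_lt hq)
  have h2 := hitCount_mono X (Set.Ici_subset_Ioi.2 hq) ω
  have h3 : 2 ^ (i + 4 + 1) = 4 * 2 ^ (i + 3) := by ring
  omega

theorem SymmSeqSpace.IsModularConst.modular_single_add_shiftRight_le
    (hK : E.IsModularConst Φ K) {m : ℝ} (hm : 0 ≤ m) {x : ℕ → 𝕜} (hx : x ∈ E.carrier) :
    Pi.single 0 (m : 𝕜) + shiftRight x ∈ E.carrier ∧
    E.modular Φ (Pi.single 0 (m : 𝕜) + shiftRight x) ≤
      K ^ 2 * (ENNReal.ofReal (Φ m) + E.modular Φ x) := by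
  have hs : shiftRight x ∈ E.carrier :=
    (E.mem_and_qnorm_le hx fun c hc => tailCount_shiftRight_le x hc).1
  have hshift : E.modular Φ (shiftRight x) ≤ E.modular Φ x := by
    simpa using hK.modular_le 0 x (shiftRight x) hx
      fun c hc => by simpa using tailCount_shiftRight_le x hc
  have hK1 : (1 : ℝ≥0∞) ≤ K := by exact_mod_cast (by have := hK.three_le; omega : 1 ≤ K)
  refine ⟨E.carrier.add_mem (E.single_mem _ _) hs, ?_⟩
  calc _ ≤ K * (E.modular Φ (Pi.single 0 (m : 𝕜)) + E.modular Φ (shiftRight x)) :=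
        hK.modular_add_le _ (E.single_mem _ _) _ hs
    _ ≤ K * (K * ENNReal.ofReal (Φ m) + K * E.modular Φ x) := by
        gcongr
        · exact hK.modular_single_le m 0 hm
        · exact hshift.trans (le_mul_of_one_le_left' hK1)
    _ = K ^ 2 * (ENNReal.ofReal (Φ m) + E.modular Φ x) := by ring

theorem SymmSeqSpace.IsModularConst.modular_quantileSeq_le_of_hitCount
    (hK : E.IsModularConst Φ K) (hX0 : ∀ k ω, 0 ≤ X k ω) {ω : Ω}
    (hω : ∀ i : ℕ, 0 < tailQuantile (sumLaw P X) (2 ^ (i + 4)) →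
      2 ^ (i + 3) ≤ hitCount X (Set.Ici (tailQuantile (sumLaw P X) (2 ^ (i + 4)))) ω) :
    E.modular Φ (quantileSeq 𝕜 (sumLaw P X)) ≤
      K ^ 6 * (ENNReal.ofReal (Φ (tailQuantile (sumLaw P X) 1)) +
        ENNReal.ofReal (Φ (E.finNorm fun k => X k ω))) := by
  obtain ⟨hmem, hle⟩ := hK.modular_single_add_shiftRight_le
    (tailQuantile_nonneg (sumLaw P X) 1) (E.extendZero_mem fun k => (X k ω : 𝕜))
  refine (hK.modular_le 4 _ _ hmem fun c hc =>
    tailCount_quantileSeq_le_of_hitCount hX0 hω hc).trans ?_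
  rw [show (6 : ℕ) = 4 + 2 from rfl, pow_add, mul_assoc]
  exact mul_le_mul_right hle _

/-- The deterministic bound W ≤ F holds off the union of the bad events, hence with probability at
least 1/2; Markov's inequality turns this into W ≤ 2∫F. -/
theorem SymmSeqSpace.IsModularConst.modular_quantileSeq_le (hK : E.IsModularConst Φ K)
    (hΦ : IsOrlicz Φ) (hX : ∀ k, Measurable (X k)) (hX0 : ∀ k ω, 0 ≤ X k ω)
    (hind : iIndepFun X P) :
    E.modular Φ (quantileSeq 𝕜 (sumLaw P X)) ≤
      2 * K ^ 6 * (ENNReal.ofReal (Φ (tailQuantile (sumLaw P X) 1)) +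
        ∫⁻ ω, ENNReal.ofReal (Φ (E.finNorm fun k => X k ω)) ∂P) := by
  set l := sumLaw P X
  set W := E.modular Φ (quantileSeq 𝕜 l)
  let B : ℕ → Set Ω := fun i => {ω | 0 < tailQuantile l (2 ^ (i + 4)) ∧
    hitCount X (Set.Ici (tailQuantile l (2 ^ (i + 4)))) ω < 2 ^ (i + 3)}
  let F : Ω → ℝ≥0∞ := fun ω => K ^ 6 * (ENNReal.ofReal (Φ (tailQuantile l 1)) +
    ENNReal.ofReal (Φ (E.finNorm fun k => X k ω)))
  have hmeas : AEMeasurable (fun ω => ENNReal.ofReal (Φ (E.finNorm fun k => X k ω))) P :=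
    (hΦ.aemeasurable_comp (E.measurable_finNorm.comp (measurable_pi_lambda _ hX)).aemeasurable
      fun ω => E.finNorm_nonneg _).ennreal_ofReal
  have hB : P (⋃ i, B i) ≤ 2⁻¹ := by
    calc P (⋃ i, B i) ≤ ∑' i, P (B i) := measure_iUnion_le _
      _ ≤ ∑' i : ℕ, ENNReal.ofReal ((1 / 4) ^ (i + 1)) :=
          ENNReal.tsum_le_tsum fun i => measure_hitCount_lt_le hX hind i
      _ = ENNReal.ofReal (1 / 3) := by
          have hsum : HasSum (fun i : ℕ => (1 / 4 : ℝ) ^ (i + 1)) (1 / 3) := by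
            have := (hasSum_geometric_of_lt_one (r := (1 / 4 : ℝ)) (by norm_num)
              (by norm_num)).mul_left (1 / 4)
            norm_num at this
            simpa [pow_succ'] using this
          rw [← ENNReal.ofReal_tsum_of_nonneg (fun i => by positivity) hsum.summable,
            hsum.tsum_eq]
      _ ≤ ENNReal.ofReal (1 / 2) := ENNReal.ofReal_le_ofReal (by norm_num)
      _ = 2⁻¹ := by rw [one_div, ENNReal.ofReal_inv_of_pos two_pos]; simp
  have hcover : Set.univ ⊆ {ω | W ≤ F ω} ∪ ⋃ i, B i := by
    intro ω _
    by_cases h : ω ∈ ⋃ i, B i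
    · exact Or.inr h
    · left
      simp only [B, Set.mem_iUnion, Set.mem_ofPred_eq, not_exists, not_and, not_lt] at h
      exact hK.modular_quantileSeq_le_of_hitCount hX0 h
  have hA : 2⁻¹ ≤ P {ω | W ≤ F ω} := by
    have h1 : (1 : ℝ≥0∞) ≤ P {ω | W ≤ F ω} + 2⁻¹ := by
      rw [← measure_univ (μ := P)]
      exact (measure_mono hcover).trans ((measure_union_le _ _).trans (by gcongr))
    rw [← ENNReal.inv_two_add_inv_two] at h1
    exact (ENNReal.add_le_add_iff_right (by simp)).1 h1
  have hmarkov : W * 2⁻¹ ≤ ∫⁻ ω, F ω ∂P :=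
    (mul_le_mul_right hA W).trans
      (mul_meas_ge_le_lintegral₀ ((aemeasurable_const.add hmeas).const_mul _) W)
  have hF : ∫⁻ ω, F ω ∂P = K ^ 6 * (ENNReal.ofReal (Φ (tailQuantile l 1)) +
      ∫⁻ ω, ENNReal.ofReal (Φ (E.finNorm fun k => X k ω)) ∂P) := by
    rw [lintegral_const_mul' _ _ (ENNReal.pow_ne_top (ENNReal.natCast_ne_top K)),
      lintegral_add_left measurable_const]
    simp
  calc W = 2 * (W * 2⁻¹) := by
        rw [mul_comm W, ← mul_assoc, ENNReal.mul_inv_cancel (by simp) (by simp), one_mul]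
    _ ≤ 2 * (K ^ 6 * (ENNReal.ofReal (Φ (tailQuantile l 1)) +
      ∫⁻ ω, ENNReal.ofReal (Φ (E.finNorm fun k => X k ω)) ∂P)) := by
        rw [← hF]; gcongr
    _ = _ := by ring

end

/-! ### The upper estimate: splitting at μ(1,f) -/

section

variable {𝕜 : Type*} [RCLike 𝕜] {Φ : ℝ → ℝ} {E : SymmSeqSpace 𝕜} {K : ℕ}
  {Ω : Type*} {n : ℕ} {X : Fin n → Ω → ℝ}

theorem IsOrlicz.measurable_upper_part (hΦ : IsOrlicz Φ) {m : ℝ} (hm : 0 ≤ m) :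
    Measurable fun x : ℝ => ENNReal.ofReal (Φ (if m < x then x else 0)) := by
  have hY : Measurable fun x : ℝ => if m < x then x else 0 :=
    Measurable.ite measurableSet_Ioi measurable_id measurable_const
  have hY0 : ∀ x : ℝ, 0 ≤ if m < x then x else 0 := fun x => by
    split_ifs with h
    · exact hm.trans h.le
    · exact le_rfl
  have := (hΦ.continuous_max.measurable.comp hY).ennreal_ofReal
  simpa only [Function.comp_def, max_eq_left (hY0 _)] using this

/-- The part of the sequence above the level `m`. -/
theorem SymmSeqSpace.IsModularConst.modular_upper_part_le (hK : E.IsModularConst Φ K)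
    (hΦ : IsOrlicz Φ) {m : ℝ} (hm : 0 ≤ m) (ω : Ω) :
    E.modular Φ (extendZero fun k => ((if m < X k ω then X k ω else 0 : ℝ) : 𝕜)) ≤
      K * ∑ k, (K : ℝ≥0∞) ^ hitCount X (Set.Ioi m) ω *
        ENNReal.ofReal (Φ (if m < X k ω then X k ω else 0)) := by
  classical
  set g : Fin n → ℝ := fun k => if m < X k ω then X k ω else 0
  set Z := hitCount X (Set.Ioi m) ω
  have hg0 : ∀ k, 0 ≤ g k := fun k => by
    simp only [g]; split_ifs with h
    · exact hm.trans h.le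
    · exact le_rfl
  -- t is the maximal entry, or 0 when there are none. At most Z ≤ 2^Z entries are nonzero and none
  -- exceeds t, so a single entry t dominates after Z doublings.
  obtain ⟨t, ht0, htg, htΦ⟩ : ∃ t : ℝ, 0 ≤ t ∧ (∀ k, g k ≤ t) ∧
      ENNReal.ofReal (Φ t) ≤ ∑ k, ENNReal.ofReal (Φ (g k)) := by
    rcases isEmpty_or_nonempty (Fin n) with h | h
    · exact ⟨0, le_rfl, fun k => h.elim k, by simp [hΦ.map_zero]⟩
    · obtain ⟨k, -, hk⟩ := Finset.exists_max_image Finset.univ g Finset.univ_nonempty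
      exact ⟨g k, hg0 k, fun i => hk i (Finset.mem_univ i),
        Finset.single_le_sum (f := fun k => ENNReal.ofReal (Φ (g k))) (fun _ _ => zero_le)
          (Finset.mem_univ k)⟩
  have hcount : ∀ c, 0 ≤ c → tailCount (extendZero fun k => ((g k : ℝ) : 𝕜)) c ≤
      2 ^ Z * tailCount (Pi.single 0 (t : 𝕜)) c := by
    intro c hc
    rw [SymmSeqSpace.tailCount_extendZero _ hc, SymmSeqSpace.tailCount_single _ hc,
      RCLike.norm_ofReal, abs_of_nonneg ht0]
    split_ifs with h
    · have h1 : (Finset.univ.filter fun k => c < ‖((g k : ℝ) : 𝕜)‖).card ≤ Z := by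
        refine Finset.card_le_card (Finset.monotone_filter_right _ fun k _ hk => ?_)
        by_contra hkm
        have : g k = 0 := if_neg hkm
        simp only [this, RCLike.ofReal_zero, norm_zero] at hk
        exact absurd hk (not_lt.2 hc)
      rw [mul_one]
      exact_mod_cast h1.trans Nat.lt_two_pow_self.le
    · have : (Finset.univ.filter fun k => c < ‖((g k : ℝ) : 𝕜)‖) = ∅ := by
        refine Finset.filter_eq_empty_iff.2 fun k _ => not_lt.2 ?_
        rw [RCLike.norm_ofReal, abs_of_nonneg (hg0 k)]
        exact (htg k).trans (not_lt.1 h)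
      rw [this]
      simp
  calc E.modular Φ (extendZero fun k => ((g k : ℝ) : 𝕜))
      ≤ K ^ Z * E.modular Φ (Pi.single 0 (t : 𝕜)) :=
        hK.modular_le Z _ _ (E.single_mem _ _) hcount
    _ ≤ K ^ Z * (K * ∑ k, ENNReal.ofReal (Φ (g k))) := by
        gcongr
        exact (hK.modular_single_le t 0 ht0).trans (by gcongr)
    _ = K * ∑ k, (K : ℝ≥0∞) ^ Z * ENNReal.ofReal (Φ (g k)) := by
        rw [← Finset.mul_sum]; ring

variable [MeasurableSpace Ω] {P : Measure Ω}

/-- The excess of the number of hits at the dyadic quantile levels, measured exponentially. -/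
noncomputable def levelExcess (P : Measure Ω) (X : Fin n → Ω → ℝ) (K : ℕ) (ω : Ω) : ℝ≥0∞ :=
  1 + ∑' j : ℕ, (K : ℝ≥0∞) ^ hitCount X (Set.Ioi (tailQuantile (sumLaw P X) (2 ^ j))) ω *
    ((K : ℝ≥0∞) ^ (K * 2 ^ j))⁻¹

theorem measurable_levelExcess (hX : ∀ k, Measurable (X k)) (K : ℕ) :
    Measurable (levelExcess P X K) :=
  measurable_const.add (Measurable.tsum fun _ =>
    (measurable_pow_hitCount hX _ measurableSet_Ioi).mul_const _)

variable [IsProbabilityMeasure P]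

/-- If no quantile exceeds c, then μ(1,f) ≤ c and the truncated sequence has no entry above c
either. Otherwise, for a count κ in [2^j, 2^(j+1)), the quantile at 2^(j+1) is at most c, and the
hypothesis there gives at most 2^(j+1)s ≤ 2^(s+1)κ entries. -/
theorem tailCount_lower_part_le (hX0 : ∀ k ω, 0 ≤ X k ω) {ω : Ω} {s : ℕ}
    (hs : ∀ j : ℕ, hitCount X (Set.Ioi (tailQuantile (sumLaw P X) (2 ^ j))) ω ≤ 2 ^ j * s)
    {c : ℝ} (hc : 0 ≤ c) :
    tailCount (extendZero fun k =>
        ((if tailQuantile (sumLaw P X) 1 < X k ω then 0 else X k ω : ℝ) : 𝕜)) c ≤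
      2 ^ (s + 1) * tailCount (quantileSeq 𝕜 (sumLaw P X)) c := by
  classical
  set l := sumLaw P X
  obtain ⟨κ, hκ, hiff⟩ := exists_tailCount_quantileSeq (𝕜 := 𝕜) (l := l) hc
  rw [SymmSeqSpace.tailCount_extendZero _ hc, hκ]
  rcases Nat.eq_zero_or_pos κ with rfl | hpos
  · have hcm : tailQuantile l 1 ≤ c := by simpa using (hiff 0).not.2 (lt_irrefl 0)
    have : (Finset.univ.filter fun k =>
        c < ‖((if tailQuantile l 1 < X k ω then 0 else X k ω : ℝ) : 𝕜)‖) = ∅ := by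
      refine Finset.filter_eq_empty_iff.2 fun k _ => not_lt.2 ?_
      rw [RCLike.norm_ofReal]
      split_ifs with h
      · simpa using hc
      · rw [abs_of_nonneg (hX0 k ω)]
        exact (not_lt.1 h).trans hcm
    rw [this]
    simp
  have h1 : (Finset.univ.filter fun k =>
      c < ‖((if tailQuantile l 1 < X k ω then 0 else X k ω : ℝ) : 𝕜)‖).card
        ≤ hitCount X (Set.Ioi c) ω := by
    refine Finset.card_le_card (Finset.monotone_filter_right _ fun k _ hk => ?_)
    rw [RCLike.norm_ofReal] at hk
    split_ifs at hk with h
    · rw [abs_zero] at hk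
      exact absurd hk (not_lt.2 hc)
    · rwa [abs_of_nonneg (hX0 k ω)] at hk
  obtain ⟨j, hj⟩ : ∃ j, Nat.log 2 κ = j := ⟨_, rfl⟩
  have hlow : 2 ^ j ≤ κ := hj ▸ Nat.pow_log_le_self 2 (by omega)
  have hup : κ < 2 ^ (j + 1) := hj ▸ Nat.lt_pow_succ_log_self (by norm_num) κ
  have hq : tailQuantile l (2 ^ (j + 1)) ≤ c := by
    have hp : 0 < 2 ^ (j + 1) := by positivity
    have := (hiff (2 ^ (j + 1) - 1)).not.2 (by omega)
    rwa [Nat.cast_sub (by omega), Nat.cast_one, sub_add_cancel, Nat.cast_pow,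
      Nat.cast_ofNat, not_lt] at this
  have h2 := hitCount_mono X (Set.Ioi_subset_Ioi hq) ω
  have h3 : 2 ^ (j + 1) * s ≤ 2 ^ (s + 1) * κ := by
    calc 2 ^ (j + 1) * s = 2 * (s * 2 ^ j) := by ring
      _ ≤ 2 * (2 ^ s * κ) := by gcongr; exact Nat.lt_two_pow_self.le
      _ = 2 ^ (s + 1) * κ := by ring
  exact_mod_cast h1.trans (h2.trans ((hs (j + 1)).trans h3))

/-- The mean count at level j is at most 2^j, so its K-exponential moment is at most exp((K-1)2^j) =
e^(-2^j)·e^(K·2^j). As e ≤ K, the normalisation K^(K·2^j) absorbs the second factor, and the first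
is at most 2^(-(j+1)). -/
theorem lintegral_levelExcess_le (hX : ∀ k, Measurable (X k)) (hind : iIndepFun X P)
    (hK : 3 ≤ K) : ∫⁻ ω, levelExcess P X K ω ∂P ≤ 2 := by
  have hK3 : (3 : ℝ) ≤ K := by exact_mod_cast hK
  have hterm : ∀ j : ℕ, ∫⁻ ω, (K : ℝ≥0∞) ^
      hitCount X (Set.Ioi (tailQuantile (sumLaw P X) (2 ^ j))) ω *
        ((K : ℝ≥0∞) ^ (K * 2 ^ j))⁻¹ ∂P ≤ 2⁻¹ ^ (j + 1) := by
    intro j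
    have hl : (sumLaw P X).real (Set.Ioi (tailQuantile (sumLaw P X) (2 ^ j))) ≤ 2 ^ j :=
      ENNReal.toReal_le_of_le_ofReal (by positivity)
        (measure_Ioi_tailQuantile_le (by positivity))
    have hexp : Real.exp ((K - 1) * 2 ^ j) ≤ (1 / 2) ^ (j + 1) * (K : ℝ) ^ (K * 2 ^ j) := by
      have h1 : Real.exp ((K - 1) * 2 ^ j) = Real.exp (-1) ^ 2 ^ j * Real.exp 1 ^ (K * 2 ^ j) := by
        rw [← Real.exp_nat_mul, ← Real.exp_nat_mul, ← Real.exp_add]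
        congr 1
        push_cast
        ring
      have h2 : Real.exp (-1) ≤ 1 / 2 := by
        rw [Real.exp_neg, inv_le_comm₀ (Real.exp_pos _) (by norm_num)]
        have := Real.exp_one_gt_d9
        norm_num
        linarith
      rw [h1]
      gcongr ?_ * ?_
      · calc Real.exp (-1) ^ 2 ^ j ≤ (1 / 2) ^ 2 ^ j := by gcongr
          _ ≤ (1 / 2) ^ (j + 1) :=
            pow_le_pow_of_le_one (by norm_num) (by norm_num) Nat.lt_two_pow_self
      · gcongr
        exact Real.exp_one_lt_three.le.trans hK3
    have hKpos : (0 : ℝ≥0∞) < (K : ℝ≥0∞) ^ (K * 2 ^ j) :=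
      ENNReal.pow_pos (by exact_mod_cast (by omega : 0 < K)) _
    have hKtop : (K : ℝ≥0∞) ^ (K * 2 ^ j) ≠ ⊤ := ENNReal.pow_ne_top (ENNReal.natCast_ne_top K)
    rw [lintegral_mul_const' _ _ (ENNReal.inv_ne_top.2 hKpos.ne'), ← div_eq_mul_inv,
      ENNReal.div_le_iff hKpos.ne' hKtop]
    have hA := lintegral_pow_hitCount_le hX hind
      (measurableSet_Ioi (a := tailQuantile (sumLaw P X) (2 ^ j))) (K.cast_nonneg (α := ℝ))
    rw [ENNReal.ofReal_natCast] at hA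
    calc _ ≤ ENNReal.ofReal (Real.exp ((K - 1) * 2 ^ j)) :=
          hA.trans (ENNReal.ofReal_le_ofReal (Real.exp_le_exp.2
            (mul_le_mul_of_nonneg_left hl (by linarith))))
      _ ≤ ENNReal.ofReal ((1 / 2) ^ (j + 1) * (K : ℝ) ^ (K * 2 ^ j)) :=
          ENNReal.ofReal_le_ofReal hexp
      _ = 2⁻¹ ^ (j + 1) * (K : ℝ≥0∞) ^ (K * 2 ^ j) := by
          rw [ENNReal.ofReal_mul (by positivity), ENNReal.ofReal_pow (by norm_num),
            ENNReal.ofReal_pow (by positivity), ENNReal.ofReal_natCast, one_div,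
            ENNReal.ofReal_inv_of_pos two_pos, ENNReal.ofReal_ofNat]
  simp only [levelExcess]
  rw [lintegral_add_left measurable_const, lintegral_tsum fun j =>
    ((measurable_pow_hitCount hX _ measurableSet_Ioi).mul_const _).aemeasurable]
  calc _ ≤ 1 + ∑' j : ℕ, (2⁻¹ : ℝ≥0∞) ^ (j + 1) := by
        gcongr with j
        · simp
        · exact hterm j
    _ = 2 := by
        rw [ENNReal.tsum_geometric_add_one, ENNReal.one_sub_inv_two,
          ENNReal.mul_inv_cancel (by simp) (by simp), one_add_one_eq_two]

theorem SymmSeqSpace.IsModularConst.modular_lower_part_le (hK : E.IsModularConst Φ K)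
    (hX : ∀ k, Measurable (X k)) (hX0 : ∀ k ω, 0 ≤ X k ω) (ω : Ω) :
    E.modular Φ (extendZero fun k =>
        ((if tailQuantile (sumLaw P X) 1 < X k ω then 0 else X k ω : ℝ) : 𝕜)) ≤
      K ^ (K + 1) * E.modular Φ (quantileSeq 𝕜 (sumLaw P X)) * levelExcess P X K ω := by
  classical
  have hK3 := hK.three_le
  let G : ℕ → ℕ := fun j => hitCount X (Set.Ioi (tailQuantile (sumLaw P X) (2 ^ j))) ω
  -- r is the least admissible excess. If r > 0, minimality yields a level j with G j > 2^j(r-1+K),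
  -- hence G j - K·2^j ≥ r, and this one term of the series is at least K^r.
  have hex : ∃ r : ℕ, ∀ j, G j ≤ 2 ^ j * (r + K) := ⟨n, fun j =>
    (hitCount_le _ _ _).trans ((Nat.le_add_right n K).trans
      (Nat.le_mul_of_pos_left _ (by positivity)))⟩
  obtain ⟨r, hr, hmin⟩ : ∃ r : ℕ, (∀ j, G j ≤ 2 ^ j * (r + K)) ∧
      ∀ i < r, ¬ ∀ j, G j ≤ 2 ^ j * (i + K) :=
    ⟨Nat.find hex, Nat.find_spec hex, fun i hi => Nat.find_min hex hi⟩
  have hpow : (K : ℝ≥0∞) ^ r ≤ levelExcess P X K ω := by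
    rcases r with _ | r
    · simp [levelExcess]
    · have := hmin r (Nat.lt_succ_self r)
      push Not at this
      obtain ⟨j, hj⟩ := this
      refine le_trans ?_ (le_add_left (ENNReal.le_tsum j))
      have hKpos : (0 : ℝ≥0∞) < (K : ℝ≥0∞) ^ (K * 2 ^ j) :=
        ENNReal.pow_pos (by exact_mod_cast (by omega : 0 < K)) _
      have hKtop : (K : ℝ≥0∞) ^ (K * 2 ^ j) ≠ ⊤ := ENNReal.pow_ne_top (ENNReal.natCast_ne_top K)
      rw [← div_eq_mul_inv, ENNReal.le_div_iff_mul_le (Or.inl hKpos.ne') (Or.inl hKtop),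
        ← pow_add]
      refine pow_le_pow_right₀ (by exact_mod_cast (by omega : 1 ≤ K)) ?_
      have h1 : r ≤ 2 ^ j * r := Nat.le_mul_of_pos_left _ (by positivity)
      have h2 : 2 ^ j * (r + K) = 2 ^ j * r + K * 2 ^ j := by ring
      show r + 1 + K * 2 ^ j ≤ G j
      omega
  have hy : quantileSeq 𝕜 (sumLaw P X) ∈ E.carrier := by
    rw [← extendZero_tailQuantile (sumLaw_le hX measurableSet_Ioi)]
    exact E.extendZero_mem _
  calc _ ≤ K ^ (r + K + 1) * E.modular Φ (quantileSeq 𝕜 (sumLaw P X)) :=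
        hK.modular_le _ _ _ hy fun c hc => tailCount_lower_part_le hX0 hr hc
    _ = K ^ (K + 1) * E.modular Φ (quantileSeq 𝕜 (sumLaw P X)) * K ^ r := by ring
    _ ≤ _ := by gcongr

/-- Above m = μ(1,f) the measure `l` has mass at most 1, so its tails there are realised by the
quantile function on (0,1). -/
theorem sum_lintegral_upper_part_le (hΦ : IsOrlicz Φ) (hX : ∀ k, Measurable (X k)) :
    ∑ k, ∫⁻ ω, ENNReal.ofReal
        (Φ (if tailQuantile (sumLaw P X) 1 < X k ω then X k ω else 0)) ∂P ≤
      ∫⁻ t, ENNReal.ofReal (Φ (tailQuantile (sumLaw P X) t)) ∂unitMeasure := by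
  set l := sumLaw P X
  set m := tailQuantile l 1
  have hm : 0 ≤ m := tailQuantile_nonneg _ _
  have hY : Measurable fun x : ℝ => if m < x then x else 0 :=
    Measurable.ite measurableSet_Ioi measurable_id measurable_const
  have hY0 : ∀ x : ℝ, 0 ≤ if m < x then x else 0 := fun x => by
    split_ifs with h
    · exact hm.trans h.le
    · exact le_rfl
  have h := hΦ.lintegral_le_of_tail (ν := l) (Y := fun x => if m < x then x else 0) (κ := 1)
    (aemeasurable_tailQuantile l) hY.aemeasurable (tailQuantile_nonneg _) hY0
    ENNReal.one_ne_top fun c hc => by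
      rw [one_mul]
      have hsub : {x : ℝ | c < if m < x then x else 0} ⊆ Set.Ioi (max m c) := by
        intro x hx
        rw [Set.mem_ofPred_eq] at hx
        split_ifs at hx with h
        · exact max_lt h hx
        · exact absurd hx (not_lt.2 hc)
      have h1 : l (Set.Ioi (max m c)) ≤ 1 :=
        (measure_mono (Set.Ioi_subset_Ioi (le_max_left _ _))).trans
          (by simpa using measure_Ioi_tailQuantile_le (l := l) one_pos)
      refine (measure_mono hsub).trans
        ((measure_Ioi_le_unitMeasure_lt_tailQuantile h1).trans (measure_mono fun t ht => ?_))
      exact (le_max_right m c).trans_lt ht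
  rwa [one_mul, lintegral_sumLaw hX (hΦ.measurable_upper_part hm)] at h

theorem SymmSeqSpace.IsModularConst.lintegral_finNorm_le (hK : E.IsModularConst Φ K)
    (hΦ : IsOrlicz Φ) (hX : ∀ k, Measurable (X k)) (hX0 : ∀ k ω, 0 ≤ X k ω)
    (hind : iIndepFun X P) :
    ∫⁻ ω, ENNReal.ofReal (Φ (E.finNorm fun k => X k ω)) ∂P ≤
      K * (K * (K * ENNReal.ofReal (Real.exp (K - 1)) *
          ∫⁻ t, ENNReal.ofReal (Φ (tailQuantile (sumLaw P X) t)) ∂unitMeasure) +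
        K ^ (K + 1) * E.modular Φ (quantileSeq 𝕜 (sumLaw P X)) * 2) := by
  set l := sumLaw P X
  set m := tailQuantile l 1
  set W := E.modular Φ (quantileSeq 𝕜 l)
  have hm : 0 ≤ m := tailQuantile_nonneg _ _
  have hK3 := hK.three_le
  let φ : ℝ → ℝ≥0∞ := fun x => ENNReal.ofReal (Φ (if m < x then x else 0))
  have hφ : Measurable φ := hΦ.measurable_upper_part hm
  have hpt : ∀ ω, ENNReal.ofReal (Φ (E.finNorm fun k => X k ω)) ≤
      K * (K * (∑ k, (K : ℝ≥0∞) ^ hitCount X (Set.Ioi m) ω * φ (X k ω)) +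
        K ^ (K + 1) * W * levelExcess P X K ω) := by
    intro ω
    have hsum : (extendZero fun k => ((X k ω : ℝ) : 𝕜)) =
        (extendZero fun k => ((if m < X k ω then X k ω else 0 : ℝ) : 𝕜)) +
        extendZero fun k => ((if m < X k ω then 0 else X k ω : ℝ) : 𝕜) := by
      ext i
      by_cases hi : i < n
      · simp only [extendZero, hi, dite_true, Pi.add_apply]
        split_ifs <;> simp
      · simp [extendZero, hi]
    show E.modular Φ (extendZero fun k => ((X k ω : ℝ) : 𝕜)) ≤ _
    rw [hsum]
    refine (hK.modular_add_le _ (E.extendZero_mem _) _ (E.extendZero_mem _)).trans ?_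
    gcongr
    · exact hK.modular_upper_part_le hΦ hm ω
    · exact hK.modular_lower_part_le hX hX0 ω
  have hup : ∫⁻ ω, ∑ k, (K : ℝ≥0∞) ^ hitCount X (Set.Ioi m) ω * φ (X k ω) ∂P ≤
      K * ENNReal.ofReal (Real.exp (K - 1)) *
        ∫⁻ t, ENNReal.ofReal (Φ (tailQuantile l t)) ∂unitMeasure := by
    have hl : l.real (Set.Ioi m) ≤ 1 :=
      ENNReal.toReal_le_of_le_ofReal zero_le_one (measure_Ioi_tailQuantile_le one_pos)
    have hK1 : (1 : ℝ) ≤ K := by exact_mod_cast (by omega : 1 ≤ K)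
    have hmeas : ∀ k, Measurable fun ω => (K : ℝ≥0∞) ^ hitCount X (Set.Ioi m) ω * φ (X k ω) :=
      fun k => (measurable_pow_hitCount hX _ measurableSet_Ioi).mul (hφ.comp (hX k))
    rw [lintegral_finsetSum _ fun k _ => hmeas k]
    calc _ ≤ ∑ k, K * ENNReal.ofReal (Real.exp (K - 1)) * ∫⁻ ω, φ (X k ω) ∂P := by
          refine Finset.sum_le_sum fun k _ => ?_
          have h := lintegral_pow_hitCount_mul_le hX hind (measurableSet_Ioi (a := m)) hK1 hφ k
          rw [ENNReal.ofReal_natCast] at h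
          refine h.trans ?_
          gcongr
          exact mul_le_of_le_one_right (by linarith) hl
      _ ≤ _ := by
          rw [← Finset.mul_sum]
          gcongr
          exact sum_lintegral_upper_part_le hΦ hX
  have hKt := ENNReal.natCast_ne_top K
  have hWt : (K : ℝ≥0∞) ^ (K + 1) * W ≠ ⊤ :=
    ENNReal.mul_ne_top (ENNReal.pow_ne_top hKt) ENNReal.ofReal_ne_top
  refine (lintegral_mono hpt).trans ?_
  rw [lintegral_const_mul' _ _ hKt, lintegral_add_right _
    ((measurable_levelExcess hX K).const_mul _), lintegral_const_mul' _ _ hKt,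
    lintegral_const_mul' _ _ hWt]
  gcongr
  exact lintegral_levelExcess_le hX hind hK3

end

/-! ### Disjoint sums -/

section

variable {𝕜 : Type*} [RCLike 𝕜] {n : ℕ}

theorem disjointSum_apply (f : Fin n → ℝ → 𝕜) (k : Fin n) {s : ℝ}
    (hs : s ∈ Set.Ioo (k : ℝ) ((k : ℝ) + 1)) : disjointSum f s = f k (s - (k : ℝ)) := by
  rw [disjointSum, Finset.sum_eq_single k]
  · rw [Set.indicator_of_mem hs]
  · intro i _ hik
    refine Set.indicator_of_notMem (fun hi => hik ?_) _
    have h1 : (i : ℝ) < (k : ℝ) + 1 := hi.1.trans hs.2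
    have h2 : (k : ℝ) < (i : ℝ) + 1 := hs.1.trans hi.2
    have h3 : (i : ℕ) < k + 1 := by exact_mod_cast h1
    have h4 : (k : ℕ) < i + 1 := by exact_mod_cast h2
    exact Fin.ext (by omega)
  · simp

/-- The level set is the disjoint union of translates of the level sets of the summands. These are
only null measurable, as the `f k` are measurable up to null sets. -/
theorem volume_lt_norm_disjointSum {f : Fin n → ℝ → 𝕜} (hf : ∀ k, AEMeasurable (f k) unitMeasure)
    {c : ℝ} (hc : 0 ≤ c) :
    volume {s : ℝ | 0 < s ∧ c < ‖disjointSum f s‖} = ∑ k, unitMeasure {t | c < ‖f k t‖} := by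
  let A : Fin n → Set ℝ := fun k => {t | c < ‖f k t‖} ∩ Set.Ioo 0 1
  let B : Fin n → Set ℝ := fun k => (fun s => s - (k : ℝ)) ⁻¹' A k
  have hmem : ∀ k s, s ∈ B k ↔ s ∈ Set.Ioo (k : ℝ) ((k : ℝ) + 1) ∧ c < ‖f k (s - (k : ℝ))‖ := by
    intro k s
    simp only [B, A, Set.mem_preimage, Set.mem_inter_iff, Set.mem_Ioo, Set.mem_ofPred_eq]
    constructor
    · rintro ⟨h3, h1, h2⟩
      exact ⟨⟨by linarith, by linarith⟩, h3⟩
    · rintro ⟨⟨h1, h2⟩, h3⟩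
      exact ⟨h3, by linarith, by linarith⟩
  have hU : {s : ℝ | 0 < s ∧ c < ‖disjointSum f s‖} = ⋃ k, B k := by
    ext s
    simp only [Set.mem_ofPred_eq, Set.mem_iUnion, hmem]
    constructor
    · rintro ⟨-, h⟩
      have hne : disjointSum f s ≠ 0 := fun h0 => by
        rw [h0, norm_zero] at h
        exact absurd h (not_lt.2 hc)
      obtain ⟨k, -, hk⟩ := Finset.exists_ne_zero_of_sum_ne_zero hne
      have hs := Set.mem_of_indicator_ne_zero hk
      exact ⟨k, hs, by rwa [disjointSum_apply f k hs] at h⟩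
    · rintro ⟨k, hs, h⟩
      exact ⟨(Nat.cast_nonneg _).trans_lt hs.1, by rwa [disjointSum_apply f k hs]⟩
  have hA : ∀ k, NullMeasurableSet (A k) volume := fun k =>
    (nullMeasurableSet_restrict measurableSet_Ioo.nullMeasurableSet).1
      ((hf k).norm.nullMeasurable measurableSet_Ioi)
  have hmp : ∀ k : Fin n, MeasurePreserving (fun s : ℝ => s - (k : ℝ)) volume volume := fun k =>
    measurePreserving_sub_right volume (k : ℝ)
  rw [hU, measure_iUnion₀ _ fun k => (hA k).preimage (hmp k).quasiMeasurePreserving,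
    tsum_fintype]
  · refine Finset.sum_congr rfl fun k _ => ?_
    rw [(hmp k).measure_preimage (hA k), unitMeasure_apply]
  · intro i k hik
    refine Disjoint.aedisjoint (Set.disjoint_left.2 fun s hi hk => hik ?_)
    have hi' := ((hmem i s).1 hi).1
    have hk' := ((hmem k s).1 hk).1
    have h1 : (i : ℝ) < (k : ℝ) + 1 := hi'.1.trans hk'.2
    have h2 : (k : ℝ) < (i : ℝ) + 1 := hk'.1.trans hi'.2
    have h3 : (i : ℕ) < k + 1 := by exact_mod_cast h1
    have h4 : (k : ℕ) < i + 1 := by exact_mod_cast h2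
    exact Fin.ext (by omega)

theorem rearrangement_disjointSum {f : Fin n → ℝ → 𝕜}
    (hf : ∀ k, AEMeasurable (f k) unitMeasure) {X : Fin n → ℝ → ℝ} (hX : ∀ k, Measurable (X k))
    (hfX : ∀ k, (fun t => ‖f k t‖) =ᵐ[unitMeasure] X k) (t : ℝ) :
    rearrangement (disjointSum f) t = tailQuantile (sumLaw unitMeasure X) t := by
  rw [rearrangement, tailQuantile]
  congr 1
  ext c
  refine and_congr_right fun hc => ?_
  rw [volume_lt_norm_disjointSum hf hc, sumLaw_apply hX measurableSet_Ioi]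
  refine iff_of_eq (congrArg (· < ENNReal.ofReal t) (Finset.sum_congr rfl fun k _ => ?_))
  refine measure_congr ?_
  filter_upwards [hfX k] with s hs
  exact propext (by change c < ‖f k s‖ ↔ c < X k s; rw [hs])

end

theorem integral_eq_toReal_and_integrable {Ω : Type*} [MeasurableSpace Ω] {μ : Measure Ω}
    {g : Ω → ℝ} (hg : AEMeasurable g μ) (hg0 : ∀ ω, 0 ≤ g ω)
    (h : ∫⁻ ω, ENNReal.ofReal (g ω) ∂μ ≠ ⊤) :
    Integrable g μ ∧ ∫ ω, g ω ∂μ = (∫⁻ ω, ENNReal.ofReal (g ω) ∂μ).toReal :=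
  ⟨(lintegral_ofReal_ne_top_iff_integrable hg.aestronglyMeasurable (Eventually.of_forall hg0)).1 h,
    integral_eq_lintegral_of_nonneg_ae (Eventually.of_forall hg0) hg.aestronglyMeasurable⟩

theorem theorem1p3 {𝕜 : Type*} [RCLike 𝕜] (Φ : ℝ → ℝ) (hΦ : IsOrlicz Φ) (hΔ : DeltaTwo Φ)
    (E : SymmSeqSpace 𝕜) :
    ∃ c C : ℝ, 0 < c ∧ 0 < C ∧
      ∀ (n : ℕ) (f : Fin n → ℝ → 𝕜),
        (∀ k, MemOrlicz Φ (f k)) → iIndepFun f unitMeasure →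
        Integrable (fun t => Φ (E.qnorm (extendZero fun k => f k t))) unitMeasure ∧
        Integrable (fun t => Φ (rearrangement (disjointSum f) t)) unitMeasure ∧
        c * ((∫ t, Φ (rearrangement (disjointSum f) t) ∂unitMeasure) +
            Φ (E.qnorm (extendZero fun k : Fin n =>
              ((rearrangement (disjointSum f) ((k : ℝ) + 1) : ℝ) : 𝕜))))
          ≤ ∫ t, Φ (E.qnorm (extendZero fun k => f k t)) ∂unitMeasure ∧
        ∫ t, Φ (E.qnorm (extendZero fun k => f k t)) ∂unitMeasure
          ≤ C * ((∫ t, Φ (rearrangement (disjointSum f) t) ∂unitMeasure) +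
            Φ (E.qnorm (extendZero fun k : Fin n =>
              ((rearrangement (disjointSum f) ((k : ℝ) + 1) : ℝ) : 𝕜)))) := by
  obtain ⟨K, hK⟩ := E.exists_isModularConst hΦ hΔ
  have hK0 : (0 : ℝ) < K := by exact_mod_cast (by have := hK.three_le; omega : 0 < K)
  -- C₁ adds the two lower estimates, with Φ(μ(1,f)) ≤ ∫Φ(μ(t,f))dt absorbed through the first; C₂
  -- is the constant of the upper estimate.
  set C₁ : ℝ := 2 * K + 2 * K ^ 6 * (2 * K + 1) with hC₁
  set C₂ : ℝ := K * (K * (K * Real.exp (K - 1)) + K ^ (K + 1) * 2) with hC₂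
  have hC₁0 : 0 < C₁ := by positivity
  have hC₂0 : 0 < C₂ := by positivity
  refine ⟨C₁⁻¹, C₂, inv_pos.2 hC₁0, hC₂0, fun n f hf hind => ?_⟩
  have hfm : ∀ k, AEMeasurable (f k) unitMeasure := fun k => (hf k).1
  let X : Fin n → ℝ → ℝ := fun k t => ‖(hfm k).mk (f k) t‖
  have hX : ∀ k, Measurable (X k) := fun k => (hfm k).measurable_mk.norm
  have hX0 : ∀ k t, 0 ≤ X k t := fun k t => norm_nonneg _
  have hfX : ∀ k, (fun t => ‖f k t‖) =ᵐ[unitMeasure] X k := fun k => by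
    filter_upwards [(hfm k).ae_eq_mk] with t ht
    simp only [X, ← ht]
  have hindX : iIndepFun X unitMeasure :=
    (hind.congr fun k => (hfm k).ae_eq_mk).comp (fun _ => norm) fun _ => measurable_norm
  have hR := rearrangement_disjointSum hfm hX hfX
  have hae : (fun t => Φ (E.qnorm (extendZero fun k => f k t))) =ᵐ[unitMeasure]
      fun t => Φ (E.finNorm fun k => X k t) := by
    filter_upwards [ae_all_iff.2 hfX] with t ht
    rw [E.qnorm_extendZero]
    simp only [ht]
  simp only [hR]
  rw [integrable_congr hae, integral_congr_ae hae,
    extendZero_tailQuantile (sumLaw_le hX measurableSet_Ioi)]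
  set l := sumLaw unitMeasure X
  set M := ∫⁻ t, ENNReal.ofReal (Φ (tailQuantile l t)) ∂unitMeasure
  set L := ∫⁻ t, ENNReal.ofReal (Φ (E.finNorm fun k => X k t)) ∂unitMeasure
  set W := E.modular Φ (quantileSeq 𝕜 l) with hWdef
  have hMtop : M ≠ ⊤ := by
    refine ((lintegral_tailQuantile_le_sum hΦ hX hX0).trans_lt (ENNReal.sum_lt_top.2
      fun k _ => ?_)).ne
    exact (lintegral_congr_ae ((hfX k).fun_comp fun x => ENNReal.ofReal (Φ x))).symm.trans_lt
      (hΦ.lintegral_lt_top hΔ (hf k))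
  have hWtop : W ≠ ⊤ := ENNReal.ofReal_ne_top
  have hupper : L ≤ ENNReal.ofReal C₂ * (M + W) := by
    have hC₂' : ENNReal.ofReal C₂ =
        K * (K * (K * ENNReal.ofReal (Real.exp (K - 1))) + K ^ (K + 1) * 2) := by
      rw [hC₂, ENNReal.ofReal_mul (by positivity), ENNReal.ofReal_add (by positivity)
        (by positivity), ENNReal.ofReal_mul (by positivity), ENNReal.ofReal_mul (by positivity),
        ENNReal.ofReal_mul (by positivity), ENNReal.ofReal_pow (by positivity),
        ENNReal.ofReal_natCast, ENNReal.ofReal_ofNat]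
    calc L ≤ K * (K * (K * ENNReal.ofReal (Real.exp (K - 1)) * M) + K ^ (K + 1) * W * 2) :=
          hK.lintegral_finNorm_le hΦ hX hX0 hindX
      _ ≤ K * (K * (K * ENNReal.ofReal (Real.exp (K - 1)) * (M + W)) +
          K ^ (K + 1) * (M + W) * 2) := by
          gcongr
          · exact le_self_add
          · exact le_add_self
      _ = ENNReal.ofReal C₂ * (M + W) := by rw [hC₂']; ring
  -- Integrability of Φ(‖(f_k(t))‖_E) is itself a consequence of the upper estimate, which was
  -- therefore proved in extended reals.
  have hLtop : L ≠ ⊤ := ne_top_of_le_ne_top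
    (ENNReal.mul_ne_top ENNReal.ofReal_ne_top (ENNReal.add_ne_top.2 ⟨hMtop, hWtop⟩)) hupper
  have hlower : M + W ≤ ENNReal.ofReal C₁ * L := by
    have h1 : M ≤ 2 * K * L := hK.lintegral_tailQuantile_le hΦ hX hindX
    have h2 : W ≤ 2 * K ^ 6 * (2 * K * L + L) :=
      (hK.modular_quantileSeq_le hΦ hX hX0 hindX).trans
        (by gcongr; exact hΦ.ofReal_tailQuantile_one_le.trans h1)
    have hC₁' : ENNReal.ofReal C₁ = 2 * K + 2 * K ^ 6 * (2 * K + 1) := by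
      rw [hC₁, ENNReal.ofReal_add (by positivity) (by positivity),
        ENNReal.ofReal_mul (by positivity), ENNReal.ofReal_mul (by positivity),
        ENNReal.ofReal_mul (by positivity), ENNReal.ofReal_add (by positivity) (by positivity),
        ENNReal.ofReal_mul (by positivity), ENNReal.ofReal_pow (by positivity),
        ENNReal.ofReal_natCast, ENNReal.ofReal_ofNat, ENNReal.ofReal_one]
    rw [hC₁']
    exact (add_le_add h1 h2).trans_eq (by ring)
  have hWreal : Φ (E.qnorm (quantileSeq 𝕜 l)) = W.toReal := by
    rw [hWdef, SymmSeqSpace.modular, ENNReal.toReal_ofReal (hΦ.nonneg (E.qnorm_nonneg _ ?_))]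
    rw [← extendZero_tailQuantile (sumLaw_le hX measurableSet_Ioi)]
    exact E.extendZero_mem _
  obtain ⟨hI1, hE1⟩ := integral_eq_toReal_and_integrable
    (hΦ.aemeasurable_comp (E.measurable_finNorm.comp (measurable_pi_lambda _ hX)).aemeasurable
      fun t => E.finNorm_nonneg _) (fun t => hΦ.nonneg (E.finNorm_nonneg _)) hLtop
  obtain ⟨hI2, hE2⟩ := integral_eq_toReal_and_integrable
    (hΦ.aemeasurable_comp (aemeasurable_tailQuantile l) (tailQuantile_nonneg l))
    (fun t => hΦ.nonneg (tailQuantile_nonneg l t)) hMtop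
  have hE1' : ∫ t, Φ (E.finNorm fun k => X k t) ∂unitMeasure = L.toReal := hE1
  have hE2' : ∫ t, Φ (tailQuantile l t) ∂unitMeasure = M.toReal := hE2
  refine ⟨hI1, hI2, ?_, ?_⟩ <;> rw [hE1', hE2', hWreal, ← ENNReal.toReal_add hMtop hWtop]
  · rw [inv_mul_le_iff₀ hC₁0]
    have := ENNReal.toReal_mono (ENNReal.mul_ne_top ENNReal.ofReal_ne_top hLtop) hlower
    rwa [ENNReal.toReal_mul, ENNReal.toReal_ofReal hC₁0.le] at this
  · have := ENNReal.toReal_mono (ENNReal.mul_ne_top ENNReal.ofReal_ne_top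
      (ENNReal.add_ne_top.2 ⟨hMtop, hWtop⟩)) hupper
    rwa [ENNReal.toReal_mul, ENNReal.toReal_ofReal hC₂0.le] at this
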